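/- Let $t$ and $c_{\max}$ be natural numbers. All graphs are finite and loopless, and parallel edges are allowed. A $c_{\max}$-colored $t$-boundaried graph is a graph whose vertices are colored with colors from $\{1,\dots,c_{\max}\}$ and in which $t$ distinct vertices (the boundary) carry the labels $1,\dots,t$. The large universe $\mathcal U^{\mathrm{large}}$ consists of all these graphs. Two of them are isomorphic, $G\cong G'$, if there is an isomorphism of the underlying graphs that preserves the colors; labels are ignored. Two of them are color-compatible if boundary vertices with the same label have the same color. For color-compatible $G,H$, let $G\oplus_c H$ be obtained from the disjoint union of $G$ and $H$ by identifying boundary vertices with the same label; otherwise $G\oplus_c H$ is undefined. The size-$t$ parsing operators are: the nullary operators $\emptyset_{n_1,\dots,n_{c_{\max}}}$ with $\sum_i n_i=t$ (the graph of $t$ isolated boundary vertices, of which the first $n_1$ have color $1$, the next $n_2$ have color $2$, and so on); the unary operator $e$ (add an edge between the vertices labeled $1$ and $2$); the unary operators $u_\ell$, $1\le\ell\le c_{\max}$ (add a new vertex of color $\ell$ with label $1$, unlabeling the vertex that was labeled $1$); the unary operator $\gamma$ (for each $j$, move label $j$ to the vertex labeled $j+1$, and label $t$ to the vertex labeled $1$);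 the unary operator $i$ (exchange the labels $1$ and $2$); and the binary operator $\oplus_c$. (The operators $e$ and $i$ are present only for $t\ge2$, and $u_\ell$ only for $t\ge 1$.) A parse tree is the rooted ordered tree of an expression over these operators, with the operators as node labels; it generates the value of the expression, if that is defined. The small universe $\mathcal U^{\mathrm{small}}\subseteq\mathcal U^{\mathrm{large}}$ consists of the graphs generated by parse trees (up to renaming vertices, labels being kept). A finite tree automaton has a finite set $Q$ of states, a finite alphabet $\Sigma$, a start state $q_0\in Q$, a set of final states, and a transition function $\delta\colon(\Sigma\times Q)\cup(\Sigma\times Q\times Q)\to Q$. On a rooted ordered binary tree with node labels from $\Sigma$, the state at a node with label $a$ is $\delta(a,q_0)$ at a leaf, $\delta(a,q)$ if its only child has state $q$, and $\delta(a,q,q')$ if its two children have states $q,q'$. It recognizes the set of those trees at whose root the state is final. Let $F\subseteq\mathcal U^{\mathrm{small}}$ be a graph problem, that is, a set such that $G\in F\iff G'\in F$ for all $G,G'\in\mathcal U^{\mathrm{small}}$ with $G\cong G'$. For $G_1,G_2\in\mathcal U^{\mathrm{large}}$, let $G_1\sim_F G_2$ if and only if $G_1$ and $G_2$ are color-compatible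 and, for every $H\in\mathcal U^{\mathrm{large}}$ that is color-compatible with them, $G_1\oplus_c H\in F\iff G_2\oplus_c H\in F$. Then the following are equivalent: (i) The set of parse trees that generate graphs in $F$ is recognizable by a finite tree automaton (over the alphabet of parsing operators). (ii) The equivalence relation $\sim_F$ has finite index over $\mathcal U^{\mathrm{small}}$, that is, its restriction to $\mathcal U^{\mathrm{small}}$ has finitely many equivalence classes. -/

import Mathlib

namespace ColoredMN

/-! ### Rooted binary labeled trees and tree automata -/

/-- Nonempty rooted (ordered) trees in which every node has at most two children and carries a
label from `σ`. -/
inductive LTree (σ : Type) : Type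
  | leaf (a : σ) : LTree σ
  | unary (a : σ) (x : LTree σ) : LTree σ
  | binary (a : σ) (x y : LTree σ) : LTree σ

/-- Deterministic leaf-to-root finite-state tree automata over a finite alphabet `σ`. The
transition function on the disjoint union of `σ × Q` and `σ × Q × Q` is given by its two parts. -/
structure TreeAutomaton (σ : Type) [Finite σ] where
  Q : Type
  finQ : Finite Q
  step₁ : σ → Q → Q
  step₂ : σ → Q → Q → Q
  start : Q
  final : Set Q

namespace TreeAutomaton

variable {σ : Type} [Finite σ]

/-- The state at the root of a tree. -/
def state (A : TreeAutomaton σ) : LTree σ → A.Q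
  | .leaf a => A.step₁ a A.start
  | .unary a x => A.step₁ a (A.state x)
  | .binary a x y => A.step₂ a (A.state x) (A.state y)

def Accepts (A : TreeAutomaton σ) (T : LTree σ) : Prop := A.state T ∈ A.final

def Recognizes (A : TreeAutomaton σ) (L : Set (LTree σ)) : Prop :=
  ∀ T : LTree σ, A.Accepts T ↔ T ∈ L

end TreeAutomaton

/-- A tree language is recognizable if some finite tree automaton recognizes it. -/
def Recognizable {σ : Type} [Finite σ] (L : Set (LTree σ)) : Prop :=
  ∃ A : TreeAutomaton σ, A.Recognizes L

/-! ### Colored boundaried graphs -/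

/-- A finite `t`-boundaried graph whose vertices are colored with `c` colors. The edges form a
multiset of two-element vertex sets (parallel edges are allowed, loops are not). The boundary
vertices are pairwise distinct; `lab j` is the one with label `j`, where the labels
`1, …, t` and the colors `1, …, c` are written `0, …, t - 1` and `0, …, c - 1`. -/
structure BGraph (t c : ℕ) where
  V : Type
  finV : Finite V
  edges : Multiset (Sym2 V)
  loopless : ∀ e ∈ edges, ¬ e.IsDiag
  color : V → Fin c
  lab : Fin t ↪ V

namespace BGraph

variable {t c : ℕ}

/-- Isomorphism of colored `t`-boundaried graphs: colors and edge multiplicities are preserved,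
labels are ignored. -/
def Iso (G H : BGraph t c) : Prop :=
  ∃ φ : G.V ≃ H.V, G.edges.map (Sym2.map φ) = H.edges ∧ ∀ v, H.color (φ v) = G.color v

/-- Isomorphism that also preserves the labels, that is, equality of boundaried graphs up to
renaming the vertices. -/
def LabIso (G H : BGraph t c) : Prop :=
  ∃ φ : G.V ≃ H.V, G.edges.map (Sym2.map φ) = H.edges ∧ (∀ v, H.color (φ v) = G.color v) ∧
    ∀ j, φ (G.lab j) = H.lab j

/-- Boundary vertices with the same label have the same color. -/
def Compat (G H : BGraph t c) : Prop :=
  ∀ j, G.color (G.lab j) = H.color (H.lab j)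

/-- The identification made by gluing. -/
def GlueRel (G H : BGraph t c) (x y : G.V ⊕ H.V) : Prop :=
  ∃ j, x = Sum.inl (G.lab j) ∧ y = Sum.inr (H.lab j)

/-- The vertices of the glued graph: the disjoint union of the vertices, where boundary vertices
with the same label are identified. -/
def GlueV (G H : BGraph t c) : Type := Quot (GlueRel G H)

def glueInl (G H : BGraph t c) (v : G.V) : GlueV G H := Quot.mk _ (Sum.inl v)

def glueInr (G H : BGraph t c) (v : H.V) : GlueV G H := Quot.mk _ (Sum.inr v)

theorem glueInl_injective (G H : BGraph t c) : Function.Injective (glueInl G H) := by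
  classical
  let r : GlueV G H → Option G.V := Quot.lift
    (Sum.elim some fun v => if h : ∃ j, H.lab j = v then some (G.lab h.choose) else none) (by
      rintro _ _ ⟨j, rfl, rfl⟩
      have h : ∃ i, H.lab i = H.lab j := ⟨j, rfl⟩
      simp only [Sum.elim_inl, Sum.elim_inr, dif_pos h]
      rw [H.lab.injective h.choose_spec])
  intro a b hab
  exact Option.some.inj (congrArg r hab)

theorem glueInr_injective (G H : BGraph t c) : Function.Injective (glueInr G H) := by
  classical
  let r : GlueV G H → Option H.V := Quot.lift
    (Sum.elim (fun v => if h : ∃ j, G.lab j = v then some (H.lab h.choose) else none) some) (by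
      rintro _ _ ⟨j, rfl, rfl⟩
      have h : ∃ i, G.lab i = G.lab j := ⟨j, rfl⟩
      simp only [Sum.elim_inl, Sum.elim_inr, dif_pos h]
      rw [G.lab.injective h.choose_spec])
  intro a b hab
  exact Option.some.inj (congrArg r hab)

/-- Images of loopless edge multisets under injective vertex maps are loopless. -/
theorem loopless_map {V W : Type} {E : Multiset (Sym2 V)} (hE : ∀ e ∈ E, ¬ e.IsDiag)
    {f : V → W} (hf : Function.Injective f) : ∀ e ∈ E.map (Sym2.map f), ¬ e.IsDiag := by
  intro e he
  obtain ⟨d, hd, rfl⟩ := Multiset.mem_map.1 he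
  intro h
  apply hE d hd
  induction d with
  | _ x y => exact hf (by simpa using h)

/-- The gluing of two color-compatible graphs; its boundary is the common boundary. -/
def glue (G H : BGraph t c) (h : Compat G H) : BGraph t c where
  V := GlueV G H
  finV := by
    have := G.finV
    have := H.finV
    exact Finite.of_surjective (Quot.mk (GlueRel G H)) Quot.mk_surjective
  edges := G.edges.map (Sym2.map (glueInl G H)) + H.edges.map (Sym2.map (glueInr G H))
  loopless := by
    intro e he
    rcases Multiset.mem_add.1 he with he | he
    · exact loopless_map G.loopless (glueInl_injective G H) e he
    · exact loopless_map H.loopless (glueInr_injective G H) e he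
  color := Quot.lift (Sum.elim G.color H.color) (by
    rintro _ _ ⟨j, rfl, rfl⟩
    exact h j)
  lab := ⟨fun j => glueInl G H (G.lab j), (glueInl_injective G H).comp G.lab.injective⟩

/-- The graph consisting of `t` isolated boundary vertices, of which the first `n 0` have
color `0`, the next `n 1` have color `1`, and so on. -/
def isolated (n : Fin c → ℕ) (h : ∑ k, n k = t) : BGraph t c where
  V := Fin t
  finV := inferInstance
  edges := 0
  loopless := by simp
  color := fun j => (finSigmaFinEquiv.symm (Fin.cast h.symm j)).1
  lab := Function.Embedding.refl _

/-- Add an edge between the boundary vertices with the first and the second label. -/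
def addEdge (h : 2 ≤ t) (G : BGraph t c) : BGraph t c where
  V := G.V
  finV := G.finV
  edges := s(G.lab ⟨0, by omega⟩, G.lab ⟨1, by omega⟩) ::ₘ G.edges
  loopless := by
    intro e he
    rcases Multiset.mem_cons.1 he with rfl | he
    · simp
    · exact G.loopless e he
  color := G.color
  lab := G.lab

/-- Add a new vertex of color `l`; it receives the first label, and the vertex that carried this
label before becomes unlabeled. -/
def newVertex (l : Fin c) (G : BGraph t c) : BGraph t c where
  V := Option G.V
  finV := by
    have := G.finV
    infer_instance
  edges := G.edges.map (Sym2.map some)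
  loopless := loopless_map G.loopless (Option.some_injective _)
  color := fun v => v.elim l G.color
  lab := ⟨fun j => if (j : ℕ) = 0 then none else some (G.lab j), by
    intro a b hab
    by_cases ha : (a : ℕ) = 0 <;> by_cases hb : (b : ℕ) = 0
    · exact Fin.ext (ha.trans hb.symm)
    · simp [ha, hb] at hab
    · simp [ha, hb] at hab
    · simpa [ha, hb] using hab⟩

/-- Relabel the boundary: label `j` moves to the vertex that carried label `p j`. -/
def relabel (p : Equiv.Perm (Fin t)) (G : BGraph t c) : BGraph t c :=
  { G with lab := p.toEmbedding.trans G.lab }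

end BGraph

/-! ### The parsing operators -/

/-- The size-`t` parsing operators for `c` colors, used as node labels of parse trees. The operators
that mention the first two labels (the first label) exist only if there are such labels. -/
inductive Op (t c : ℕ) : Type
  | isolated (n : Fin c → ℕ) (h : ∑ k, n k = t) : Op t c
  | edge (h : 2 ≤ t) : Op t c
  | new (h : 1 ≤ t) (l : Fin c) : Op t c
  | shift : Op t c
  | swap (h : 2 ≤ t) : Op t c
  | glue : Op t c

instance Op.instFinite (t c : ℕ) : Finite (Op t c) := by
  let f : Op t c → (Fin c → Fin (t + 1)) ⊕ (Fin c ⊕ Fin 4)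
    | .isolated n h => Sum.inl fun k => ⟨n k, by
        have := Finset.single_le_sum (f := n) (fun _ _ => Nat.zero_le _) (Finset.mem_univ k)
        omega⟩
    | .new _ l => Sum.inr (Sum.inl l)
    | .edge _ => Sum.inr (Sum.inr 0)
    | .shift => Sum.inr (Sum.inr 1)
    | .swap _ => Sum.inr (Sum.inr 2)
    | .glue => Sum.inr (Sum.inr 3)
  refine Finite.of_injective f ?_
  intro a b hab
  cases a <;> cases b <;> simp [f, funext_iff] at hab ⊢ <;> exact hab

namespace Op

variable {t c : ℕ}

/-- The values of the nullary operators. -/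
def eval₀ : Op t c → Option (BGraph t c)
  | .isolated n h => some (BGraph.isolated n h)
  | _ => none

/-- The values of the unary operators. -/
def eval₁ : Op t c → BGraph t c → Option (BGraph t c)
  | .edge h, G => some (G.addEdge h)
  | .new _ l, G => some (G.newVertex l)
  | .shift, G => some (G.relabel (finRotate t))
  | .swap h, G => some (G.relabel (Equiv.swap ⟨0, by omega⟩ ⟨1, by omega⟩))
  | _, _ => none

open Classical in
/-- The value of the binary operator; it is undefined on color-incompatible graphs. -/
noncomputable def eval₂ : Op t c → BGraph t c → BGraph t c → Option (BGraph t c)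
  | .glue, G, H => if h : G.Compat H then some (G.glue H h) else none
  | _, _, _ => none

end Op

variable {t c : ℕ}

/-- The graph generated by a tree, undefined if the tree is not the parse tree of an expression
over the parsing operators (a node with the wrong number of children) or if it glues
color-incompatible graphs. -/
noncomputable def eval : LTree (Op t c) → Option (BGraph t c)
  | .leaf a => a.eval₀
  | .unary a x => (eval x).bind a.eval₁
  | .binary a x y => (eval x).bind fun G => (eval y).bind fun H => a.eval₂ G H

/-- The small universe: the graphs that are generated by the parsing operators (up to the choice of
the vertex names, with labels preserved). -/
def smallUniverse (t c : ℕ) : Set (BGraph t c) :=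
  {G | ∃ T : LTree (Op t c), ∃ G' : BGraph t c, eval T = some G' ∧ G'.LabIso G}

/-- The parse trees generating the graphs in `F`. -/
def parseTrees (F : Set (BGraph t c)) : Set (LTree (Op t c)) :=
  {T | ∃ G ∈ F, eval T = some G}

/-- The canonical right congruence of `F` on the large universe. -/
def canonicalCongruence (F : Set (BGraph t c)) : Setoid (BGraph t c) where
  r G₁ G₂ := G₁.Compat G₂ ∧ ∀ (H : BGraph t c) (h₁ : G₁.Compat H) (h₂ : G₂.Compat H),
    G₁.glue H h₁ ∈ F ↔ G₂.glue H h₂ ∈ F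
  iseqv :=
    { refl := fun _ => ⟨fun _ => rfl, fun _ _ _ => Iff.rfl⟩
      symm := fun h => ⟨fun j => (h.1 j).symm, fun H h₁ h₂ => (h.2 H h₂ h₁).symm⟩
      trans := fun h h' => ⟨fun j => (h.1 j).trans (h'.1 j), fun H h₁ h₂ =>
        (h.2 H h₁ fun j => (h'.1 j).trans (h₂ j)).trans (h'.2 H _ h₂)⟩ }

/-- The canonical right congruence of `F` restricted to the small universe. -/
def smallCongruence (F : Set (BGraph t c)) : Setoid (smallUniverse t c) :=
  (canonicalCongruence F).comap Subtype.val

/-- Membership in `F` is an isomorphism-invariant property of the graphs of the small universe. -/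
def IsoInvariantOnSmall (F : Set (BGraph t c)) : Prop :=
  ∀ G ∈ smallUniverse t c, ∀ G' ∈ smallUniverse t c, G.Iso G' → (G ∈ F ↔ G' ∈ F)

end ColoredMN

/-! The difficulty is that `canonicalCongruence` tests with arbitrary graphs `H`, whereas an
automaton sees only graphs that have parse trees. It is removed by `mem_smallUniverse_of_glue`: if
`G ⊕ H` lies in the small universe, then so does `H`. To see this, the small universe is described
as the graphs with a tree decomposition into bags of exactly `t` vertices, where adjacent bags
differ by at most one exchange and the boundary is the root bag (`exists_decomp_of_eval`,
`RootedDecomp.generates`). Such decompositions restrict to every vertex set containing the root bag.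
Since bags must keep their size, the restriction is done after forgetting the root (`SeqDecomp`),
and the result is rooted again at the boundary.

Recognizability gives finite index: let `K₁`, `K₂` have equal boundary colors and parse trees
reaching the same state. If `K₁ ⊕ H ∈ F`, then `H` has a parse tree, and gluing it to either tree
leads to the same state, so `K₂ ⊕ H ∈ F`. The index is thus bounded by the number of pairs of a
state and a boundary coloring.

Conversely, `profile` records the boundary colors and the completions inside the small universe
only, so on that universe its kernel is coarser than the given congruence and has finitely many
classes. Each operator can be moved across a gluing: `(op G) ⊕ H ≅ G ⊕ H'`, where `H'` is again in
the small universe and depends only on `H`, the operator with its other operand, and the boundary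
colors of `G`. Hence equality of profiles is a congruence for all operators (`profile_congr`), and
its classes serve as states (`recognizable_of_congruence`). -/

namespace ColoredMN

/-! ### Tree decompositions into bags of constant size -/

/-- `RootedDecomp t X 𝓑 B`: the vertex set `X` has a tree decomposition with set of bags `𝓑`, all of
size `t`, and root bag `B`, in which adjacent bags differ in the exchange of at most one vertex. -/
inductive RootedDecomp {V : Type} (t : ℕ) : Set V → Set (Set V) → Set V → Prop
  | bag (B : Set V) (h : B.ncard = t) : RootedDecomp t B {B} B
  | extend {X : Set V} {𝓑 : Set (Set V)} {B : Set V} (v b : V) (h : RootedDecomp t X 𝓑 B)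
      (hv : v ∉ X) (hb : b ∈ B) :
      RootedDecomp t (insert v X) (insert (insert v (B \ {b})) 𝓑) (insert v (B \ {b}))
  | glue {X₁ X₂ : Set V} {𝓑₁ 𝓑₂ : Set (Set V)} {B : Set V} (h₁ : RootedDecomp t X₁ 𝓑₁ B)
      (h₂ : RootedDecomp t X₂ 𝓑₂ B) (h : X₁ ∩ X₂ = B) : RootedDecomp t (X₁ ∪ X₂) (𝓑₁ ∪ 𝓑₂) B

/-- `SeqDecomp t X 𝓑`: the vertex set `X` has a decomposition with set of bags `𝓑`, all of size `t`,
in which the vertices are added one by one, as in the construction of a `(t - 1)`-tree. -/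
inductive SeqDecomp {V : Type} (t : ℕ) : Set V → Set (Set V) → Prop
  | bag (B : Set V) (h : B.ncard = t) : SeqDecomp t B {B}
  | extend {X : Set V} {𝓑 : Set (Set V)} {C : Set V} (v b : V) (h : SeqDecomp t X 𝓑)
      (hC : C ∈ 𝓑) (hv : v ∉ X) (hb : b ∈ C) :
      SeqDecomp t (insert v X) (insert (insert v (C \ {b})) 𝓑)

theorem ncard_exchange {V : Type} [Finite V] {B : Set V} {v b : V} (hv : v ∉ B) (hb : b ∈ B) :
    (insert v (B \ {b})).ncard = B.ncard := by
  rw [Set.ncard_insert_of_notMem (fun h => hv h.1), Set.ncard_sdiff_singleton_add_one hb]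

theorem exchange_exchange {V : Type} {B : Set V} {v b : V} (hv : v ∉ B) (hb : b ∈ B) :
    insert b (insert v (B \ {b}) \ {v}) = B := by
  ext x
  simp only [Set.mem_insert_iff, Set.mem_sdiff, Set.mem_singleton_iff]
  by_cases hxb : x = b
  · subst hxb; simp [hb]
  · by_cases hxv : x = v
    · subst hxv; simp [hv, hxb]
    · simp [hxb, hxv]

/-! ### Basic properties and grafting of rooted decompositions -/

namespace RootedDecomp

variable {V : Type} {t : ℕ} {X X₁ X₂ : Set V} {𝓑 𝓑₁ 𝓑₂ : Set (Set V)} {B D : Set V}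

theorem root_mem (h : RootedDecomp t X 𝓑 B) : B ∈ 𝓑 := by
  induction h with
  | bag B h => rfl
  | extend v b h hv hb ih => exact Set.mem_insert _ _
  | glue h₁ h₂ h ih₁ ih₂ => exact Or.inl ih₁

theorem bag_subset (h : RootedDecomp t X 𝓑 B) : ∀ C ∈ 𝓑, C ⊆ X := by
  induction h with
  | bag B h => rintro C rfl; exact subset_rfl
  | extend v b h hv hb ih =>
    rintro C (rfl | hC)
    · exact Set.insert_subset_insert (Set.sdiff_subset.trans (ih _ h.root_mem))
    · exact (ih C hC).trans (Set.subset_insert _ _)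
  | glue h₁ h₂ h ih₁ ih₂ =>
    rintro C (hC | hC)
    · exact (ih₁ C hC).trans Set.subset_union_left
    · exact (ih₂ C hC).trans Set.subset_union_right

theorem root_subset (h : RootedDecomp t X 𝓑 B) : B ⊆ X := h.bag_subset B h.root_mem

theorem ncard_bag [Finite V] (h : RootedDecomp t X 𝓑 B) : ∀ C ∈ 𝓑, C.ncard = t := by
  induction h with
  | bag B h => rintro C rfl; exact h
  | extend v b h hv hb ih =>
    rintro C (rfl | hC)
    · rw [ncard_exchange (fun hh => hv (h.root_subset hh)) hb, ih _ h.root_mem]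
    · exact ih C hC
  | glue h₁ h₂ h ih₁ ih₂ => rintro C (hC | hC) <;> aesop

theorem map {W : Type} {f : V → W} (hf : Function.Injective f) (h : RootedDecomp t X 𝓑 B) :
    RootedDecomp t (f '' X) ((f '' ·) '' 𝓑) (f '' B) := by
  induction h with
  | bag B h => simpa using bag (f '' B) (by rw [Set.ncard_image_of_injective _ hf, h])
  | extend v b h hv hb ih =>
    have := extend (f v) (f b) ih (by simpa [hf.eq_iff] using hv) (Set.mem_image_of_mem f hb)
    simpa [Set.image_insert_eq, Set.image_sdiff hf] using this
  | glue h₁ h₂ h ih₁ ih₂ =>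
    have := glue ih₁ ih₂ (by rw [← Set.image_inter hf, h])
    simpa [Set.image_union] using this

/-- The constructor `glue` joins at root bags only. Here the second decomposition hangs at an inner
bag: it is glued in where that bag is a root, and the later construction steps are replayed on top.
They stay legal because the two parts share only vertices of `B`. -/
theorem graft (h : RootedDecomp t X₁ 𝓑₁ D) (hB : B ∈ 𝓑₁) (h₂ : RootedDecomp t X₂ 𝓑₂ B)
    (hX : X₁ ∩ X₂ = B) : RootedDecomp t (X₁ ∪ X₂) (𝓑₁ ∪ 𝓑₂) D := by
  induction h with
  | bag D hD =>
    obtain rfl : B = D := hB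
    exact glue (bag B hD) h₂ hX
  | @extend X 𝓑 C v b h hv hb ih =>
    rcases hB with rfl | hB
    · exact glue (extend v b h hv hb) h₂ hX
    · have hBX := h.bag_subset _ hB
      have hv₂ : v ∉ X₂ := fun hv₂ => hv (hBX (hX ▸ ⟨Set.mem_insert _ _, hv₂⟩))
      have := extend v b (ih hB (by
        rw [Set.insert_inter_of_notMem hv₂] at hX; exact hX)) (by simp [hv, hv₂]) hb
      simpa [Set.insert_union] using this
  | @glue Y₁ Y₂ 𝓒₁ 𝓒₂ D g₁ g₂ h ih₁ ih₂ =>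
    rcases hB with hB | hB
    · have hBX := g₁.bag_subset _ hB
      have := glue (ih₁ hB (by
        apply subset_antisymm
        · rw [← hX]; gcongr; exact Set.subset_union_left
        · exact Set.subset_inter hBX (hX ▸ Set.inter_subset_right))) g₂ (by
        rw [Set.union_inter_distrib_right, h, Set.union_eq_left]
        intro x hx
        have : x ∈ B := hX ▸ ⟨Or.inr hx.2, hx.1⟩
        exact h ▸ ⟨hBX this, hx.2⟩)
      simpa only [Set.union_right_comm] using this
    · have hBX := g₂.bag_subset _ hB
      have := glue g₁ (ih₂ hB (by
        apply subset_antisymm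
        · rw [← hX]; gcongr; exact Set.subset_union_right
        · exact Set.subset_inter hBX (hX ▸ Set.inter_subset_right))) (by
        rw [Set.inter_union_distrib_left, h, Set.union_eq_left]
        intro x hx
        have : x ∈ B := hX ▸ ⟨Or.inl hx.1, hx.2⟩
        exact h ▸ ⟨hx.1, hBX this⟩)
      simpa only [Set.union_assoc] using this

end RootedDecomp

/-! ### Unrooting, rerooting and restricting decompositions -/

namespace SeqDecomp

variable {V : Type} {t : ℕ} {X X₁ X₂ : Set V} {𝓑 𝓑₁ 𝓑₂ : Set (Set V)} {B : Set V}

theorem bag_subset (h : SeqDecomp t X 𝓑) : ∀ C ∈ 𝓑, C ⊆ X := by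
  induction h with
  | bag B h => rintro C rfl; exact subset_rfl
  | extend v b h hC hv hb ih =>
    rintro C (rfl | hC')
    · exact Set.insert_subset_insert (Set.sdiff_subset.trans (ih _ hC))
    · exact (ih C hC').trans (Set.subset_insert _ _)

theorem ncard_bag [Finite V] (h : SeqDecomp t X 𝓑) : ∀ C ∈ 𝓑, C.ncard = t := by
  induction h with
  | bag B h => rintro C rfl; exact h
  | extend v b h hC hv hb ih =>
    rintro C (rfl | hC')
    · rw [ncard_exchange (fun hh => hv (h.bag_subset _ hC hh)) hb, ih _ hC]
    · exact ih C hC'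

/-- The rooted decomposition is unfolded from its root downwards, which reverses its exchanges: the
sequence already has the bag containing `v`, so `b` is the vertex to add and `v` the one to drop. -/
theorem graft (h : RootedDecomp t X₂ 𝓑₂ B) : ∀ {X₁ : Set V} {𝓑₁ : Set (Set V)},
    SeqDecomp t X₁ 𝓑₁ → B ∈ 𝓑₁ → X₁ ∩ X₂ = B → SeqDecomp t (X₁ ∪ X₂) (𝓑₁ ∪ 𝓑₂) := by
  induction h with
  | bag B hB =>
    intro X₁ 𝓑₁ h₁ hB₁ hX
    rwa [Set.union_eq_left.2 (Set.inter_eq_right.1 hX),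
      Set.union_eq_left.2 (Set.singleton_subset_iff.2 hB₁)]
  | @extend X 𝓑 C v b h hv hb ih =>
    intro X₁ 𝓑₁ h₁ hB hX
    have hvC : v ∉ C := fun hh => hv (h.root_subset hh)
    have hbX := h.root_subset hb
    have hvb : v ≠ b := fun hh => hv (hh ▸ hbX)
    have hb₁ : b ∉ X₁ := by
      intro hh
      have : b ∈ insert v (C \ {b}) := hX ▸ ⟨hh, Set.mem_insert_of_mem _ hbX⟩
      simp [hvb.symm] at this
    have hv₁ : v ∈ X₁ := h₁.bag_subset _ hB (Set.mem_insert _ _)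
    have h₃ := h₁.extend b v hB hb₁ (Set.mem_insert _ _)
    rw [exchange_exchange hvC hb] at h₃
    have := ih h₃ (Set.mem_insert _ _) (by
      rw [← exchange_exchange hvC hb, ← hX]
      ext x
      simp only [Set.mem_inter_iff, Set.mem_insert_iff, Set.mem_sdiff, Set.mem_singleton_iff]
      constructor
      · rintro ⟨rfl | h1, h2⟩
        · exact Or.inl rfl
        · exact Or.inr ⟨⟨h1, Or.inr h2⟩, fun hh => hv (hh ▸ h2)⟩
      · rintro (rfl | ⟨⟨h1, rfl | h2⟩, h3⟩)
        · exact ⟨Or.inl rfl, hbX⟩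
        · exact absurd rfl h3
        · exact ⟨Or.inr h1, h2⟩)
    convert this using 1
    · ext x
      simp only [Set.mem_union, Set.mem_insert_iff]
      constructor
      · rintro (h | rfl | h) <;> simp [*]
      · rintro ((rfl | h) | h) <;> simp [*]
    · ext x
      simp only [Set.mem_union, Set.mem_insert_iff]
      constructor
      · rintro (h | rfl | h) <;> simp [*]
      · rintro ((rfl | h') | h') <;> simp [*, h.root_mem]
  | @glue Y₁ Y₂ 𝓒₁ 𝓒₂ D g₁ g₂ h ih₁ ih₂ =>
    intro X₁ 𝓑₁ h₁ hB hX
    have hD₁ := h₁.bag_subset _ hB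
    have := ih₂ (ih₁ h₁ hB (by
      apply subset_antisymm
      · rw [← hX]; gcongr; exact Set.subset_union_left
      · exact Set.subset_inter hD₁ g₁.root_subset)) (Or.inl hB) (by
        rw [Set.union_inter_distrib_right, h, Set.union_eq_right]
        rw [← hX]; gcongr; exact Set.subset_union_right)
    simpa only [Set.union_assoc] using this

/-- A rooted decomposition gives a sequential one. -/
theorem of_rooted [Finite V] (h : RootedDecomp t X 𝓑 B) : SeqDecomp t X 𝓑 := by
  -- The sequence starts with the root bag alone, and all the rest is grafted onto it.
  have := graft h (bag B (h.ncard_bag B h.root_mem)) rfl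
    (Set.inter_eq_left.2 h.root_subset)
  rwa [Set.union_eq_right.2 h.root_subset,
    Set.union_eq_right.2 (Set.singleton_subset_iff.2 h.root_mem)] at this

/-- A sequential decomposition can be rooted at each of its bags. -/
theorem rooted [Finite V] (h : SeqDecomp t X 𝓑) : ∀ D ∈ 𝓑, RootedDecomp t X 𝓑 D := by
  induction h with
  | bag B h => rintro D rfl; exact .bag D h
  | @extend X 𝓑 C v b h hC hv hb ih =>
    have hvC : v ∉ C := fun hh => hv (h.bag_subset _ hC hh)
    have hvb : v ≠ b := fun hh => hvC (hh ▸ hb)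
    rintro D (rfl | hD)
    · exact (ih C hC).extend v b hv hb
    -- To keep an older bag `D` as root, the newest bag is attached below `C` as a two-bag
    -- decomposition of `insert v C` rooted at `C`: start from the new bag and exchange back.
    · have brick := (RootedDecomp.bag (insert v (C \ {b}))
        ((ncard_exchange hvC hb).trans (h.ncard_bag C hC))).extend b v
        (by simp [hvb.symm]) (Set.mem_insert _ _)
      rw [exchange_exchange hvC hb] at brick
      have hins : insert b (insert v (C \ {b})) = insert v C := by
        rw [Set.insert_comm, Set.insert_sdiff_singleton, Set.insert_eq_of_mem hb]
      rw [hins] at brick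
      have := (ih D hD).graft hC brick (by
        rw [Set.inter_insert_of_notMem hv, Set.inter_eq_right.2 (h.bag_subset _ hC)])
      convert this using 1
      · rw [Set.union_insert, Set.union_eq_left.2 (h.bag_subset _ hC)]
      · ext x
        simp only [Set.mem_union, Set.mem_insert_iff, Set.mem_singleton_iff]
        constructor
        · rintro (rfl | h) <;> simp [*]
        · rintro (h' | rfl | h') <;> simp [*]

/-- Sequential decompositions restrict to sets of at least `t` vertices. -/
theorem restrict [Finite V] (h : SeqDecomp t X 𝓑) : ∀ Y ⊆ X, t ≤ Y.ncard →
    ∃ 𝓒, SeqDecomp t Y 𝓒 ∧ ∀ C ∈ 𝓑, ∃ D ∈ 𝓒, C ∩ Y ⊆ D := by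
  induction h with
  | bag B h =>
    intro Y hY ht
    obtain rfl : Y = B := Set.eq_of_subset_of_ncard_le hY (h ▸ ht)
    exact ⟨{Y}, bag Y h, fun C hC => ⟨Y, rfl, Set.inter_subset_right⟩⟩
  | @extend X 𝓑 C v b h hC hv hb ih =>
    intro Y hY ht
    by_cases hvY : v ∈ Y
    -- Without `v`, fewer than `t` vertices would remain for the induction, but then `Y` itself is a
    -- bag.
    · by_cases htY : Y.ncard = t
      · exact ⟨{Y}, bag Y htY, fun C hC => ⟨Y, rfl, Set.inter_subset_right⟩⟩
      · have hY' : Y \ {v} ⊆ X := by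
          rintro x ⟨hx, hxv⟩
          exact (hY hx).resolve_left hxv
        obtain ⟨𝓒, h𝓒, hsub⟩ := ih (Y \ {v}) hY' (by
          have := Set.ncard_sdiff_singleton_add_one hvY
          omega)
        obtain ⟨D, hD, hCD⟩ := hsub C hC
        -- The vertex `b` need not lie in `D`. Since `D` has `t` vertices and `C \ {b}` only `t -
        -- 1`, some `d` can be dropped from `D` in its place without losing what must be covered.
        obtain ⟨d, hdD, hd⟩ : ∃ d ∈ D, d ∉ C \ {b} := by
          by_contra! hcon
          have h1 := Set.ncard_le_ncard (show D ⊆ C \ {b} from hcon)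
          have h2 := Set.ncard_sdiff_singleton_add_one hb
          have h3 := h.ncard_bag C hC
          have h4 := h𝓒.ncard_bag D hD
          omega
        refine ⟨_, by simpa [Set.insert_eq_of_mem hvY] using h𝓒.extend v d hD (by simp) hdD, ?_⟩
        rintro C' (rfl | hC')
        · refine ⟨_, Set.mem_insert _ _, ?_⟩
          rintro x ⟨rfl | hx, hxY⟩
          · exact Set.mem_insert _ _
          · have hxv : x ≠ v := fun hh => hv (hh ▸ h.bag_subset _ hC hx.1)
            exact Or.inr ⟨hCD ⟨hx.1, hxY, hxv⟩, fun hh => hd (hh ▸ hx)⟩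
        · obtain ⟨D', hD', hs⟩ := hsub C' hC'
          refine ⟨D', Set.mem_insert_of_mem _ hD', ?_⟩
          rintro x ⟨hx, hxY⟩
          have hxv : x ≠ v := fun hh => hv (hh ▸ h.bag_subset _ hC' hx)
          exact hs ⟨hx, hxY, hxv⟩
    · obtain ⟨𝓒, h𝓒, hsub⟩ := ih Y (fun x hx => (hY hx).resolve_left fun hh => hvY (hh ▸ hx)) ht
      refine ⟨𝓒, h𝓒, ?_⟩
      rintro C' (rfl | hC')
      · obtain ⟨D, hD, hs⟩ := hsub C hC
        refine ⟨D, hD, ?_⟩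
        rintro x ⟨rfl | hx, hxY⟩
        · exact absurd hxY hvY
        · exact hs ⟨hx.1, hxY⟩
      · exact hsub C' hC'

end SeqDecomp

/-- A rooted decomposition restricts to every set of vertices that contains the root bag. -/
theorem RootedDecomp.restrict {V : Type} [Finite V] {t : ℕ} {X Y : Set V} {𝓑 : Set (Set V)}
    {B : Set V} (h : RootedDecomp t X 𝓑 B) (hY : Y ⊆ X) (hB : B ⊆ Y) :
    ∃ 𝓒, RootedDecomp t Y 𝓒 B ∧ ∀ C ∈ 𝓑, ∃ D ∈ 𝓒, C ∩ Y ⊆ D := by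
  have hBt := h.ncard_bag B h.root_mem
  obtain ⟨𝓒, h𝓒, hs⟩ := (SeqDecomp.of_rooted h).restrict Y hY (hBt ▸ Set.ncard_le_ncard hB)
  refine ⟨𝓒, ?_, hs⟩
  -- Some bag covers `B`, and equal size makes it equal to `B`, so the restricted sequence can be
  -- rooted there.
  obtain ⟨D, hD, hBD⟩ := hs B h.root_mem
  rw [Set.inter_eq_left.2 hB] at hBD
  obtain rfl := Set.eq_of_subset_of_ncard_le hBD (by rw [h𝓒.ncard_bag D hD, hBt])
  exact h𝓒.rooted B hD

/-! ### Gluing and isomorphisms -/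

namespace BGraph

variable {t c : ℕ}

theorem map_map_edges {U V W : Type} (E : Multiset (Sym2 U)) (f : U → V) (g : V → W) :
    (E.map (Sym2.map f)).map (Sym2.map g) = E.map (Sym2.map (g ∘ f)) := by
  rw [Multiset.map_map, ← Sym2.map_comp]

theorem glueV_cases {G H : BGraph t c} (x : GlueV G H) :
    (∃ a, glueInl G H a = x) ∨ ∃ b, glueInr G H b = x := by
  induction x using Quot.ind with
  | mk x =>
    rcases x with a | b
    · exact Or.inl ⟨a, rfl⟩
    · exact Or.inr ⟨b, rfl⟩

theorem glueInl_lab (G H : BGraph t c) (j : Fin t) :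
    glueInl G H (G.lab j) = glueInr G H (H.lab j) := Quot.sound ⟨j, rfl, rfl⟩

theorem glueInl_eq_glueInr {G H : BGraph t c} {a : G.V} {b : H.V} :
    glueInl G H a = glueInr G H b ↔ ∃ j, a = G.lab j ∧ b = H.lab j := by
  constructor
  · intro hab
    -- This predicate on the quotient expresses being the class of `a`; transporting it along `hab`
    -- exposes the common label.
    let p : GlueV G H → Prop := Quot.lift
      (Sum.elim (fun a' => a' = a) fun b' => ∃ j, a = G.lab j ∧ b' = H.lab j) (by
        rintro _ _ ⟨j, rfl, rfl⟩
        apply propext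
        constructor
        · rintro rfl
          exact ⟨j, rfl, rfl⟩
        · rintro ⟨i, rfl, hi⟩
          rw [H.lab.injective hi]
          rfl)
    have : p (glueInl G H a) := (rfl : a = a)
    rw [hab] at this
    exact this
  · rintro ⟨j, rfl, rfl⟩
    exact glueInl_lab G H j

/-- The universal property of gluing, for injective maps. -/
theorem exists_glue_desc {G H : BGraph t c} {V : Type} {f₁ : G.V → V} {f₂ : H.V → V}
    (h₁ : Function.Injective f₁) (h₂ : Function.Injective f₂)
    (hf : ∀ a b, f₁ a = f₂ b ↔ ∃ j, a = G.lab j ∧ b = H.lab j) :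
    ∃ f : GlueV G H → V, Function.Injective f ∧ (∀ a, f (glueInl G H a) = f₁ a) ∧
      ∀ b, f (glueInr G H b) = f₂ b := by
  refine ⟨Quot.lift (Sum.elim f₁ f₂) ?_, ?_, fun _ => rfl, fun _ => rfl⟩
  · rintro _ _ ⟨j, rfl, rfl⟩
    exact (hf _ _).2 ⟨j, rfl, rfl⟩
  · intro x y hxy
    rcases glueV_cases x with ⟨a, rfl⟩ | ⟨a, rfl⟩ <;> rcases glueV_cases y with ⟨b, rfl⟩ | ⟨b, rfl⟩
    · exact congrArg _ (h₁ hxy)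
    · exact glueInl_eq_glueInr.2 ((hf _ _).1 hxy)
    · exact (glueInl_eq_glueInr.2 ((hf _ _).1 hxy.symm)).symm
    · exact congrArg _ (h₂ hxy)

theorem map_glue_edges {G H : BGraph t c} (h : Compat G H) {V : Type} {f : GlueV G H → V}
    {f₁ : G.V → V} {f₂ : H.V → V} (h₁ : ∀ a, f (glueInl G H a) = f₁ a)
    (h₂ : ∀ b, f (glueInr G H b) = f₂ b) :
    (G.glue H h).edges.map (Sym2.map f) = G.edges.map (Sym2.map f₁) + H.edges.map (Sym2.map f₂) := by
  obtain rfl : f ∘ glueInl G H = f₁ := funext h₁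
  obtain rfl : f ∘ glueInr G H = f₂ := funext h₂
  change (G.edges.map (Sym2.map (glueInl G H)) + H.edges.map (Sym2.map (glueInr G H))).map
    (Sym2.map f) = _
  rw [Multiset.map_add, map_map_edges, map_map_edges]

/-- A graph covered by embedded copies of `G` and `H` that meet exactly in equally labeled boundary
vertices is the gluing of `G` and `H`. -/
theorem exists_glue_equiv {G H K : BGraph t c} (h : Compat G H) {f₁ : G.V → K.V} {f₂ : H.V → K.V}
    (h₁ : Function.Injective f₁) (h₂ : Function.Injective f₂)
    (hf : ∀ a b, f₁ a = f₂ b ↔ ∃ j, a = G.lab j ∧ b = H.lab j)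
    (hs : ∀ x, (∃ a, f₁ a = x) ∨ ∃ b, f₂ b = x)
    (he : G.edges.map (Sym2.map f₁) + H.edges.map (Sym2.map f₂) = K.edges)
    (hc₁ : ∀ a, K.color (f₁ a) = G.color a) (hc₂ : ∀ b, K.color (f₂ b) = H.color b) :
    ∃ φ : (G.glue H h).V ≃ K.V, (G.glue H h).edges.map (Sym2.map φ) = K.edges ∧
      (∀ v, K.color (φ v) = (G.glue H h).color v) ∧ ∀ j, φ ((G.glue H h).lab j) = f₁ (G.lab j) := by
  obtain ⟨f, hfi, hf₁, hf₂⟩ := exists_glue_desc h₁ h₂ hf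
  have hsurj : Function.Surjective f := fun x => by
    rcases hs x with ⟨a, rfl⟩ | ⟨b, rfl⟩
    · exact ⟨_, hf₁ a⟩
    · exact ⟨_, hf₂ b⟩
  refine ⟨Equiv.ofBijective f ⟨hfi, hsurj⟩, (map_glue_edges h hf₁ hf₂).trans he, fun v => ?_,
    fun j => hf₁ _⟩
  rcases glueV_cases v with ⟨a, rfl⟩ | ⟨b, rfl⟩
  · exact (congrArg K.color (hf₁ a)).trans (hc₁ a)
  · exact (congrArg K.color (hf₂ b)).trans (hc₂ b)

theorem glue_iso {G H K : BGraph t c} (h : Compat G H) {f₁ : G.V → K.V} {f₂ : H.V → K.V}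
    (h₁ : Function.Injective f₁) (h₂ : Function.Injective f₂)
    (hf : ∀ a b, f₁ a = f₂ b ↔ ∃ j, a = G.lab j ∧ b = H.lab j)
    (hs : ∀ x, (∃ a, f₁ a = x) ∨ ∃ b, f₂ b = x)
    (he : G.edges.map (Sym2.map f₁) + H.edges.map (Sym2.map f₂) = K.edges)
    (hc₁ : ∀ a, K.color (f₁ a) = G.color a) (hc₂ : ∀ b, K.color (f₂ b) = H.color b) :
    (G.glue H h).Iso K := by
  obtain ⟨φ, h1, h2, -⟩ := exists_glue_equiv h h₁ h₂ hf hs he hc₁ hc₂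
  exact ⟨φ, h1, h2⟩

theorem LabIso.iso {G H : BGraph t c} (h : G.LabIso H) : G.Iso H := by
  obtain ⟨φ, h1, h2, -⟩ := h
  exact ⟨φ, h1, h2⟩

theorem LabIso.refl (G : BGraph t c) : G.LabIso G := ⟨Equiv.refl _, by simp, by simp, by simp⟩

theorem LabIso.color_lab {G H : BGraph t c} (h : G.LabIso H) (j : Fin t) :
    G.color (G.lab j) = H.color (H.lab j) := by
  obtain ⟨φ, -, h2, h3⟩ := h
  rw [← h3, h2]

theorem LabIso.glue {G G' H H' : BGraph t c} (hG : G.LabIso G') (hH : H.LabIso H')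
    (h : G.Compat H) (h' : G'.Compat H') : (G.glue H h).LabIso (G'.glue H' h') := by
  obtain ⟨φ, h1, h2, h3⟩ := hG
  obtain ⟨ψ, h4, h5, h6⟩ := hH
  obtain ⟨χ, h7, h8, h9⟩ := exists_glue_equiv (K := G'.glue H' h') h
    (f₁ := fun a => glueInl G' H' (φ a)) (f₂ := fun b => glueInr G' H' (ψ b))
    ((glueInl_injective _ _).comp φ.injective) ((glueInr_injective _ _).comp ψ.injective)
    (fun a b => glueInl_eq_glueInr.trans (by
      simp only [← h3, ← h6, φ.injective.eq_iff, ψ.injective.eq_iff]))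
    (fun x => by
      rcases glueV_cases x with ⟨a, rfl⟩ | ⟨b, rfl⟩
      · exact Or.inl ⟨φ.symm a, congrArg _ (φ.apply_symm_apply a)⟩
      · exact Or.inr ⟨ψ.symm b, congrArg _ (ψ.apply_symm_apply b)⟩)
    (by
      change _ = G'.edges.map (Sym2.map (glueInl G' H')) + H'.edges.map (Sym2.map (glueInr G' H'))
      rw [← h1, ← h4, map_map_edges, map_map_edges]
      rfl)
    h2 h5
  exact ⟨χ, h7, h8, fun j => (h9 j).trans (congrArg _ (h3 j))⟩

end BGraph

/-! ### Graphs generated inside an ambient vertex set -/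

open BGraph

variable {t c : ℕ}

/-- The graph on the vertex set `X` with edges `E`, boundary `ℓ` and the colors given by `col` is a
copy of a graph that is generated by a parse tree. -/
def Generates {V : Type} (col : V → Fin c) (X : Set V) (E : Multiset (Sym2 V)) (ℓ : Fin t → V) :
    Prop :=
  ∃ (T : LTree (Op t c)) (G : BGraph t c), eval T = some G ∧ ∃ f : G.V → V,
    Function.Injective f ∧ Set.range f = X ∧ G.edges.map (Sym2.map f) = E ∧
      (∀ v, col (f v) = G.color v) ∧ ∀ j, f (G.lab j) = ℓ j

theorem mem_smallUniverse_iff {G : BGraph t c} :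
    G ∈ smallUniverse t c ↔ Generates G.color Set.univ G.edges G.lab := by
  constructor
  · rintro ⟨T, G', hT, φ, h1, h2, h3⟩
    exact ⟨T, G', hT, φ, φ.injective, φ.surjective.range_eq, h1, h2, h3⟩
  · rintro ⟨T, G', hT, f, hf, hX, h1, h2, h3⟩
    exact ⟨T, G', hT, Equiv.ofBijective f ⟨hf, Set.range_eq_univ.1 hX⟩, h1, h2, h3⟩

/-- The nullary operators list the boundary in blocks of equal color. Sorting the labels by color
reduces an arbitrary coloring to this order. -/
theorem exists_isolated_relabel (κ : Fin t → Fin c) : ∃ (n : Fin c → ℕ) (h : ∑ k, n k = t)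
    (p : Equiv.Perm (Fin t)), ∀ j, (isolated n h).color (p j) = κ j := by
  let n : Fin c → ℕ := fun k => Fintype.card {j // κ j = k}
  have h : ∑ k, n k = t := by
    rw [← Fintype.card_sigma, Fintype.card_congr (Equiv.sigmaFiberEquiv κ), Fintype.card_fin]
  let p : Fin t ≃ Fin t := (Equiv.sigmaFiberEquiv κ).symm.trans
    ((Equiv.sigmaCongrRight fun k => Fintype.equivFin {j // κ j = k}).trans
      (finSigmaFinEquiv.trans (finCongr h)))
  refine ⟨n, h, p, fun j => ?_⟩
  have : finSigmaFinEquiv.symm (Fin.cast h.symm (p j)) =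
      (Equiv.sigmaCongrRight fun k => Fintype.equivFin {j // κ j = k})
        ((Equiv.sigmaFiberEquiv κ).symm j) := by
    rw [Equiv.symm_apply_eq]
    rfl
  change (finSigmaFinEquiv.symm (Fin.cast h.symm (p j))).1 = _
  rw [this]
  rfl

/-- The size-`t` parsing operators generate all permutations of the labels. -/
theorem perm_induction {M : Equiv.Perm (Fin t) → Prop} (one : M 1)
    (shift : ∀ p, M p → M (p * finRotate t))
    (swap : ∀ (h : 2 ≤ t) (p), M p → M (p * Equiv.swap ⟨0, by omega⟩ ⟨1, by omega⟩))
    (p : Equiv.Perm (Fin t)) : M p := by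
  by_cases ht : 2 ≤ t
  · have h0 : finRotate t ⟨0, by omega⟩ = ⟨1, by omega⟩ := by
      obtain ⟨n, rfl⟩ : ∃ n, t = n + 1 := ⟨t - 1, by omega⟩
      exact finRotate_of_lt (by omega)
    have hp : p ∈ Submonoid.closure
        {finRotate t, Equiv.swap (⟨0, by omega⟩ : Fin t) ⟨1, by omega⟩} := by
      -- In a finite group inverses are powers, so products of the full cycle and an adjacent
      -- transposition already give every permutation.
      rw [← Subgroup.closure_toSubmonoid_of_finite, ← h0,
        Equiv.Perm.closure_cycle_adjacent_swap (isCycle_finRotate_of_le ht)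
          (support_finRotate_of_le ht)]
      trivial
    have : ∀ q, M q → M (q * p) := by
      induction hp using Submonoid.closure_induction with
      | mem x hx =>
        rcases hx with rfl | rfl
        · exact shift
        · exact swap ht
      | one => simp
      | mul x y hx hy ihx ihy => exact fun q hq => mul_assoc q x y ▸ ihy _ (ihx q hq)
    simpa using this 1 one
  · have : Subsingleton (Fin t) := Fin.subsingleton_iff_le_one.2 (by omega)
    rwa [Subsingleton.elim p 1]

namespace Generates

variable {V : Type} {col : V → Fin c} {X X₁ X₂ : Set V} {E E₁ E₂ : Multiset (Sym2 V)}
  {ℓ : Fin t → V}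

theorem relabel (h : Generates col X E ℓ) (p : Equiv.Perm (Fin t)) :
    Generates col X E (ℓ ∘ p) := by
  induction p using perm_induction with
  | one => exact h
  | shift p ih =>
    obtain ⟨T, G, hT, f, hf, h1, h2, h3, h4⟩ := ih
    refine ⟨.unary .shift T, G.relabel (finRotate t), by simp [eval, hT, Op.eval₁], f, hf, h1, h2,
      h3, fun j => h4 _⟩
  | swap ht p ih =>
    obtain ⟨T, G, hT, f, hf, h1, h2, h3, h4⟩ := ih
    refine ⟨.unary (.swap ht) T, G.relabel (Equiv.swap ⟨0, by omega⟩ ⟨1, by omega⟩),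
      by simp [eval, hT, Op.eval₁], f, hf, h1, h2, h3, fun j => h4 _⟩

theorem isolated (hℓ : Function.Injective ℓ) : Generates col (Set.range ℓ) 0 ℓ := by
  obtain ⟨n, h, p, hp⟩ := exists_isolated_relabel (col ∘ ℓ)
  have : Generates col (Set.range ℓ) 0 (ℓ ∘ p.symm) := by
    refine ⟨.leaf (.isolated n h), BGraph.isolated n h, rfl, ℓ ∘ p.symm,
      hℓ.comp p.symm.injective, ?_, rfl, fun v => ?_, fun j => rfl⟩
    · exact p.symm.surjective.range_comp ℓ
    · exact (hp (p.symm v)).symm.trans (congrArg (BGraph.isolated n h).color (p.apply_symm_apply v))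
  simpa [Function.comp_assoc] using this.relabel p

/-- Move the labels `i` and `j` to the first two positions, apply the operator, and move them back.
-/
theorem addEdge (h : Generates col X E ℓ) {i j : Fin t} (hij : i ≠ j) :
    Generates col X (s(ℓ i, ℓ j) ::ₘ E) ℓ := by
  have ht : 2 ≤ t := by
    by_contra hlt
    have : Subsingleton (Fin t) := Fin.subsingleton_iff_le_one.2 (by omega)
    exact hij (Subsingleton.elim i j)
  let x : Fin t := ⟨0, by omega⟩
  let y : Fin t := ⟨1, by omega⟩
  have hxy : x ≠ y := by simp [x, y]
  obtain ⟨p, hpx, hpy⟩ : ∃ p : Equiv.Perm (Fin t), p x = i ∧ p y = j := by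
    refine ⟨(Equiv.swap x i).trans (Equiv.swap (Equiv.swap x i y) j), ?_, ?_⟩
    · rw [Equiv.trans_apply, Equiv.swap_apply_left]
      refine Equiv.swap_apply_of_ne_of_ne (fun hh => hxy ?_) hij
      have := congrArg (Equiv.swap x i) hh
      simpa using this
    · simp
  obtain ⟨T, G, hT, f, hf, h1, h2, h3, h4⟩ := h.relabel p
  have : Generates col X (s(ℓ i, ℓ j) ::ₘ E) (ℓ ∘ p) := by
    refine ⟨.unary (.edge ht) T, G.addEdge ht, by simp [eval, hT, Op.eval₁], f, hf, h1, ?_, h3, h4⟩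
    have hx := h4 x
    have hy := h4 y
    simp only [Function.comp, hpx, hpy] at hx hy
    rw [← hx, ← hy, ← h2]
    exact Multiset.map_cons _ _ _
  simpa [Function.comp_assoc] using this.relabel p⁻¹

theorem newVertex (h : Generates col X E ℓ) {v : V} (hv : v ∉ X) (i : Fin t) :
    Generates col (insert v X) E (Function.update ℓ i v) := by
  have ht : 1 ≤ t := i.pos
  let x : Fin t := ⟨0, by omega⟩
  obtain ⟨T, G, hT, f, hf, h1, h2, h3, h4⟩ := h.relabel (Equiv.swap x i)
  have : Generates col (insert v X) E (Function.update ℓ i v ∘ Equiv.swap x i) := by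
    refine ⟨.unary (.new ht (col v)) T, G.newVertex (col v), by simp [eval, hT, Op.eval₁],
      fun o => Option.elim o v f, ?_, ?_, ?_, ?_, ?_⟩
    · rintro (_ | a) (_ | b) hab
      · rfl
      · exact absurd (h1 ▸ ⟨b, hab.symm⟩) hv
      · exact absurd (h1 ▸ ⟨a, hab⟩) hv
      · exact congrArg some (hf hab)
    · rw [← h1]
      ext w
      simp [BGraph.newVertex, Option.exists, eq_comm]
    · exact (map_map_edges G.edges some _).trans h2
    · rintro (_ | a)
      · rfl
      · exact h3 a
    · intro j
      change Option.elim (if (j : ℕ) = 0 then none else some (G.lab j)) v f = _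
      by_cases hj : (j : ℕ) = 0
      · obtain rfl : j = x := Fin.ext hj
        simp [x]
      · have hjx : j ≠ x := fun hh => hj (congrArg Fin.val hh)
        have : Equiv.swap x i j ≠ i := fun hh => hjx (by
          rw [Equiv.swap_apply_eq_iff] at hh
          simpa using hh)
        simpa [hj, Function.update_of_ne this] using h4 j
  simpa [Function.comp_assoc, ← Equiv.coe_trans] using this.relabel (Equiv.swap x i)

theorem glue (h₁ : Generates col X₁ E₁ ℓ) (h₂ : Generates col X₂ E₂ ℓ)
    (h : X₁ ∩ X₂ = Set.range ℓ) : Generates col (X₁ ∪ X₂) (E₁ + E₂) ℓ := by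
  obtain ⟨T₁, G₁, hT₁, f₁, hf₁, rfl, rfl, hc₁, hl₁⟩ := h₁
  obtain ⟨T₂, G₂, hT₂, f₂, hf₂, rfl, rfl, hc₂, hl₂⟩ := h₂
  have hG : G₁.Compat G₂ := fun j => by rw [← hc₁, ← hc₂, hl₁, hl₂]
  obtain ⟨f, hf, hfl, hfr⟩ := exists_glue_desc hf₁ hf₂ (fun a b => by
    constructor
    · intro hab
      obtain ⟨j, hj⟩ : f₁ a ∈ Set.range ℓ := h ▸ ⟨⟨a, rfl⟩, ⟨b, hab.symm⟩⟩
      exact ⟨j, hf₁ (by rw [hl₁, hj]), hf₂ (by rw [hl₂, hj, hab])⟩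
    · rintro ⟨j, rfl, rfl⟩
      rw [hl₁, hl₂])
  refine ⟨.binary .glue T₁ T₂, G₁.glue G₂ hG, by simp [eval, hT₁, hT₂, Op.eval₂, hG], f, hf, ?_,
    map_glue_edges hG hfl hfr, fun x => ?_, fun j => (hfl _).trans (hl₁ j)⟩
  · ext x
    constructor
    · rintro ⟨y, rfl⟩
      rcases glueV_cases y with ⟨a, rfl⟩ | ⟨b, rfl⟩
      · exact Or.inl ⟨a, (hfl a).symm⟩
      · exact Or.inr ⟨b, (hfr b).symm⟩
    · rintro (⟨a, rfl⟩ | ⟨b, rfl⟩)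
      · exact ⟨_, hfl a⟩
      · exact ⟨_, hfr b⟩
  · rcases glueV_cases x with ⟨a, rfl⟩ | ⟨b, rfl⟩
    · exact (congrArg col (hfl a)).trans (hc₁ a)
    · exact (congrArg col (hfr b)).trans (hc₂ b)

theorem map {W : Type} {col' : W → Fin c} {f : V → W} (hf : Function.Injective f)
    (hc : ∀ v, col' (f v) = col v) (h : Generates col X E ℓ) :
    Generates col' (f '' X) (E.map (Sym2.map f)) (f ∘ ℓ) := by
  obtain ⟨T, G, hT, g, hg, rfl, rfl, h3, h4⟩ := h
  refine ⟨T, G, hT, f ∘ g, hf.comp hg, Set.range_comp f g, ?_, fun v => (hc _).trans (h3 v),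
    fun j => congrArg f (h4 j)⟩
  exact (map_map_edges _ _ _).symm

end Generates

/-! ### The small universe in terms of decompositions -/

/-- Every edge has both ends in a common member of `𝓑`. -/
def EdgesInBags {V : Type} (E : Multiset (Sym2 V)) (𝓑 : Set (Set V)) : Prop :=
  ∀ e ∈ E, ∃ C ∈ 𝓑, ∀ x ∈ e, x ∈ C

theorem EdgesInBags.map {V W : Type} {E : Multiset (Sym2 V)} {𝓑 : Set (Set V)}
    (h : EdgesInBags E 𝓑) (f : V → W) : EdgesInBags (E.map (Sym2.map f)) ((f '' ·) '' 𝓑) := by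
  intro e he
  obtain ⟨d, hd, rfl⟩ := Multiset.mem_map.1 he
  obtain ⟨C, hC, hdC⟩ := h d hd
  refine ⟨_, ⟨C, hC, rfl⟩, fun x hx => ?_⟩
  obtain ⟨y, hy, rfl⟩ := Sym2.mem_map.1 hx
  exact ⟨y, hdC y hy, rfl⟩

theorem EdgesInBags.mono {V : Type} {E : Multiset (Sym2 V)} {𝓑 𝓒 : Set (Set V)}
    (h : EdgesInBags E 𝓑) (hs : 𝓑 ⊆ 𝓒) : EdgesInBags E 𝓒 := fun e he => by
  obtain ⟨C, hC, hdC⟩ := h e he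
  exact ⟨C, hs hC, hdC⟩

theorem EdgesInBags.add {V : Type} {E E' : Multiset (Sym2 V)} {𝓑 : Set (Set V)}
    (h : EdgesInBags E 𝓑) (h' : EdgesInBags E' 𝓑) : EdgesInBags (E + E') 𝓑 := fun e he =>
  (Multiset.mem_add.1 he).elim (h e) (h' e)

theorem Generates.addEdges {V : Type} {col : V → Fin c} {X : Set V} {E : Multiset (Sym2 V)}
    {ℓ : Fin t → V} (h : Generates col X E ℓ) (E' : Multiset (Sym2 V))
    (hl : ∀ e ∈ E', ¬ e.IsDiag) (hE' : ∀ e ∈ E', ∀ x ∈ e, x ∈ Set.range ℓ) :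
    Generates col X (E' + E) ℓ := by
  induction E' using Multiset.induction with
  | empty => simpa using h
  | cons e E' ih =>
    have h' := ih (fun e he => hl e (Multiset.mem_cons_of_mem he))
      fun e he => hE' e (Multiset.mem_cons_of_mem he)
    have hd := hl e (Multiset.mem_cons_self _ _)
    have hr := hE' e (Multiset.mem_cons_self _ _)
    induction e with
    | _ x y =>
      obtain ⟨i, rfl⟩ := hr x (Sym2.mem_mk_left _ _)
      obtain ⟨j, rfl⟩ := hr y (Sym2.mem_mk_right _ _)
      rw [Multiset.cons_add]
      exact h'.addEdge fun hij => hd (by simp [hij])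

/-- Generation is reflected by embeddings. This returns from a copy inside a glued graph to the
original graph. -/
theorem Generates.of_map {V W : Type} {col : V → Fin c} {col' : W → Fin c} {X : Set V}
    {E : Multiset (Sym2 V)} {ℓ : Fin t → V} {f : V → W} (hf : Function.Injective f)
    (hc : ∀ v, col' (f v) = col v)
    (h : Generates col' (f '' X) (E.map (Sym2.map f)) (f ∘ ℓ)) : Generates col X E ℓ := by
  obtain ⟨T, G, hT, g, hg, h1, h2, h3, h4⟩ := h
  have : ∀ v, ∃ x ∈ X, f x = g v := fun v => h1.subset (Set.mem_range_self v)
  choose k hkX hk using this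
  obtain rfl : f ∘ k = g := funext hk
  refine ⟨T, G, hT, k, hg.of_comp, ?_, ?_, fun v => (hc _).symm.trans (h3 v), fun j => hf (h4 j)⟩
  · rw [Set.range_comp] at h1
    exact hf.image_injective h1
  · rw [← map_map_edges] at h2
    exact Multiset.map_injective (Sym2.map.injective hf) h2

theorem RootedDecomp.congr {V : Type} {X X' B B' : Set V} {𝓑 : Set (Set V)}
    (h : RootedDecomp t X 𝓑 B) (hX : X = X') (hB : B = B') : RootedDecomp t X' 𝓑 B' :=
  hX ▸ hB ▸ h

theorem range_update_of_injective {α β : Type} [DecidableEq α] {ℓ : α → β}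
    (hℓ : Function.Injective ℓ) (i : α) (b : β) :
    Set.range (Function.update ℓ i b) = insert b (Set.range ℓ \ {ℓ i}) := by
  ext x
  constructor
  · rintro ⟨j, rfl⟩
    by_cases hj : j = i
    · subst hj; simp
    · simp [hℓ.eq_iff, hj]
  · rintro (rfl | ⟨⟨j, rfl⟩, hj⟩)
    · exact ⟨i, by simp⟩
    · exact ⟨j, Function.update_of_ne (fun hh => hj (congrArg ℓ hh)) _ _⟩

theorem injective_update {α β : Type} [DecidableEq α] {ℓ : α → β}
    (hℓ : Function.Injective ℓ) (i : α) {b : β} (hb : b ∉ Set.range ℓ) :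
    Function.Injective (Function.update ℓ i b) := by
  intro x y hxy
  by_cases hx : x = i <;> by_cases hy : y = i
  · rw [hx, hy]
  · subst hx
    rw [Function.update_self, Function.update_of_ne hy] at hxy
    exact absurd ⟨y, hxy.symm⟩ hb
  · subst hy
    rw [Function.update_self, Function.update_of_ne hx] at hxy
    exact absurd ⟨x, hxy⟩ hb
  · rw [Function.update_of_ne hx, Function.update_of_ne hy] at hxy
    exact hℓ hxy

/-- Graphs with edges inside the bags of a decomposition are generated by the operators. -/
theorem RootedDecomp.generates {V : Type} {col : V → Fin c} {X B : Set V}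
    {𝓑 : Set (Set V)} (h : RootedDecomp t X 𝓑 B) : ∀ {E : Multiset (Sym2 V)} {ℓ : Fin t → V},
    (∀ e ∈ E, ¬ e.IsDiag) → EdgesInBags E 𝓑 → Function.Injective ℓ → Set.range ℓ = B →
      Generates col X E ℓ := by
  classical
  induction h with
  | bag B hB =>
    rintro E ℓ hl hE hℓ rfl
    simpa using (Generates.isolated hℓ).addEdges E hl fun e he x hx => by
      obtain ⟨C, rfl, hC⟩ := hE e he
      exact hC x hx
  | @extend X 𝓑 B v b h hv hb ih =>
    intro E ℓ hl hE hℓ hr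
    have hvB : v ∉ B := fun hh => hv (h.root_subset hh)
    have hvb : v ≠ b := fun hh => hvB (hh ▸ hb)
    obtain ⟨i, hi⟩ : v ∈ Set.range ℓ := hr ▸ Set.mem_insert _ _
    have hbr : b ∉ Set.range ℓ := by
      rw [hr]
      simp [hvb.symm]
    -- The graph before `v` was added: `b` holds the label of `v`, and the edges at `v` are set
    -- aside. These all lie in the new root bag, so they can be added once `v` is present.
    have h₀ := ih (E := E.filter (fun e => ¬ v ∈ e)) (ℓ := Function.update ℓ i b)
      (fun e he => hl e (Multiset.mem_of_mem_filter he))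
      (fun e he => by
        obtain ⟨heE, hve⟩ := Multiset.mem_filter.1 he
        obtain ⟨C, rfl | hC, heC⟩ := hE e heE
        · refine ⟨B, h.root_mem, fun x hx => ?_⟩
          rcases heC x hx with rfl | hxB
          · exact absurd hx hve
          · exact hxB.1
        · exact ⟨C, hC, heC⟩)
      (injective_update hℓ i hbr)
      (by rw [range_update_of_injective hℓ, hr, hi, exchange_exchange hvB hb])
    have h₁ := h₀.newVertex hv i
    rw [Function.update_idem, ← hi, Function.update_eq_self, hi] at h₁
    rw [← Multiset.filter_add_not (fun e => v ∈ e) E]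
    refine h₁.addEdges _ (fun e he => hl e (Multiset.mem_of_mem_filter he)) fun e he x hx => ?_
    obtain ⟨heE, hve⟩ := Multiset.mem_filter.1 he
    obtain ⟨C, rfl | hC, heC⟩ := hE e heE
    · exact hr ▸ heC x hx
    · exact absurd (h.bag_subset C hC (heC v hve)) hv
  | @glue X₁ X₂ 𝓑₁ 𝓑₂ B h₁ h₂ h ih₁ ih₂ =>
    intro E ℓ hl hE hℓ hr
    -- An edge inside the common boundary may fit both sides; sending it to the first side keeps
    -- multiplicities right.
    let p : Sym2 V → Prop := fun e => ∃ C ∈ 𝓑₁, ∀ x ∈ e, x ∈ C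
    rw [← Multiset.filter_add_not p E]
    refine (ih₁ (fun e he => hl e (Multiset.mem_of_mem_filter he)) (fun e he => ?_) hℓ hr).glue
      (ih₂ (fun e he => hl e (Multiset.mem_of_mem_filter he)) (fun e he => ?_) hℓ hr)
      (h.trans hr.symm)
    · exact (Multiset.mem_filter.1 he).2
    · obtain ⟨heE, hpe⟩ := Multiset.mem_filter.1 he
      obtain ⟨C, hC | hC, heC⟩ := hE e heE
      · exact absurd ⟨C, hC, heC⟩ hpe
      · exact ⟨C, hC, heC⟩

/-! ### From parse trees to decompositions -/

theorem ncard_range_lab (G : BGraph t c) : (Set.range G.lab).ncard = t := by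
  rw [← Set.image_univ, Set.ncard_image_of_injective _ G.lab.injective]
  simp

theorem range_relabel (p : Equiv.Perm (Fin t)) (G : BGraph t c) :
    Set.range (G.relabel p).lab = Set.range G.lab := p.surjective.range_comp G.lab

/-- Nullary operators give a single bag, new vertices are exchanges at the root, and gluing joins at
the root. Relabelings and edges keep the decomposition, a new edge lying in the root bag. -/
theorem exists_decomp_of_eval (T : LTree (Op t c)) : ∀ {G : BGraph t c}, eval T = some G →
    ∃ 𝓑, RootedDecomp t Set.univ 𝓑 (Set.range G.lab) ∧ EdgesInBags G.edges 𝓑 := by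
  induction T with
  | leaf a =>
    intro G hG
    cases a <;> simp only [eval, Op.eval₀, reduceCtorEq, Option.some.injEq] at hG
    subst hG
    refine ⟨{Set.univ}, ?_, fun e he => absurd he (Multiset.notMem_zero _)⟩
    have : Set.range (BGraph.isolated _ (by assumption) : BGraph t c).lab = Set.univ :=
      Set.range_id
    have h := RootedDecomp.bag _ (ncard_range_lab (BGraph.isolated _ (by assumption) : BGraph t c))
    rwa [this] at h ⊢
  | unary a x ih =>
    intro G hG
    obtain ⟨G', hx, ha⟩ := Option.bind_eq_some_iff.1 hG
    obtain ⟨𝓑, h, hE⟩ := ih hx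
    cases a <;> simp only [Op.eval₁, reduceCtorEq, Option.some.injEq] at ha <;> subst ha
    case edge ht =>
      refine ⟨𝓑, h, fun e he => ?_⟩
      rcases Multiset.mem_cons.1 he with rfl | he
      · refine ⟨_, h.root_mem, fun x hx => ?_⟩
        rcases Sym2.mem_iff.1 hx with rfl | rfl <;> exact Set.mem_range_self _
      · exact hE e he
    case new ht l =>
      have h' := (h.map (Option.some_injective _)).extend none (some (G'.lab ⟨0, ht⟩)) (by simp)
        (Set.mem_image_of_mem _ (Set.mem_range_self _))
      refine ⟨_, h'.congr ?_ ?_, (hE.map some).mono (Set.subset_insert _ _)⟩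
      · exact Set.eq_univ_of_forall fun x => by cases x <;> simp
      · refine Set.ext fun x => Iff.symm ?_
        constructor
        · rintro ⟨j, rfl⟩
          change (if (j : ℕ) = 0 then none else some (G'.lab j)) ∈ _
          by_cases hj : (j : ℕ) = 0
          · simp [hj]
          · simp only [hj, if_false]
            refine Or.inr ⟨⟨_, ⟨j, rfl⟩, rfl⟩, fun hh => hj ?_⟩
            have := G'.lab.injective (Option.some.inj hh)
            rw [this]
        · rintro (rfl | ⟨⟨_, ⟨j, rfl⟩, rfl⟩, hj⟩)
          · exact ⟨⟨0, ht⟩, rfl⟩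
          · refine ⟨j, if_neg fun hh => hj ?_⟩
            obtain rfl : j = ⟨0, ht⟩ := Fin.ext hh
            rfl
    case shift => exact ⟨𝓑, (range_relabel _ G').symm ▸ h, hE⟩
    case swap => exact ⟨𝓑, (range_relabel _ G').symm ▸ h, hE⟩
  | binary a x y ihx ihy =>
    intro G hG
    obtain ⟨G₁, hx, hG⟩ := Option.bind_eq_some_iff.1 hG
    obtain ⟨G₂, hy, ha⟩ := Option.bind_eq_some_iff.1 hG
    obtain ⟨𝓑₁, h₁, hE₁⟩ := ihx hx
    obtain ⟨𝓑₂, h₂, hE₂⟩ := ihy hy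
    cases a <;> simp only [Op.eval₂, reduceCtorEq] at ha
    split_ifs at ha with hc
    obtain rfl := Option.some.inj ha
    have h₁' := h₁.map (glueInl_injective G₁ G₂)
    have h₂' := h₂.map (glueInr_injective G₁ G₂)
    have hr₁ : glueInl G₁ G₂ '' Set.range G₁.lab = Set.range (G₁.glue G₂ hc).lab :=
      (Set.range_comp _ _).symm
    have hr₂ : glueInr G₁ G₂ '' Set.range G₂.lab = Set.range (G₁.glue G₂ hc).lab := by
      rw [← Set.range_comp]
      exact congrArg Set.range (funext fun j => (glueInl_lab G₁ G₂ j).symm)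
    rw [hr₁] at h₁'
    rw [hr₂] at h₂'
    refine ⟨_, (h₁'.glue h₂' ?_).congr ?_ rfl, ((hE₁.map _).mono Set.subset_union_left).add
      ((hE₂.map _).mono Set.subset_union_right)⟩
    · refine Set.ext fun x => ?_
      constructor
      · rintro ⟨⟨a, -, rfl⟩, b, -, hab⟩
        obtain ⟨j, rfl, rfl⟩ := glueInl_eq_glueInr.1 hab.symm
        exact ⟨j, rfl⟩
      · rintro ⟨j, rfl⟩
        exact ⟨⟨_, trivial, rfl⟩, _, trivial, (glueInl_lab G₁ G₂ j).symm⟩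
    · refine Set.eq_univ_of_forall fun x => ?_
      rcases glueV_cases x with ⟨a, rfl⟩ | ⟨b, rfl⟩
      · exact Or.inl ⟨a, trivial, rfl⟩
      · exact Or.inr ⟨b, trivial, rfl⟩

theorem exists_decomp {G : BGraph t c} (hG : G ∈ smallUniverse t c) :
    ∃ 𝓑, RootedDecomp t Set.univ 𝓑 (Set.range G.lab) ∧ EdgesInBags G.edges 𝓑 := by
  obtain ⟨T, G', hT, φ, h1, h2, h3⟩ := hG
  obtain ⟨𝓑, h, hE⟩ := exists_decomp_of_eval T hT
  refine ⟨_, ?_, h1 ▸ hE.map φ⟩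
  have := h.map φ.injective
  rwa [Set.image_univ, φ.surjective.range_eq, ← Set.range_comp,
    show φ ∘ G'.lab = G.lab from funext h3] at this

/-- If a gluing lies in the small universe, then so does its second part. -/
theorem mem_smallUniverse_of_glue {G H : BGraph t c} {h : G.Compat H}
    (hGH : G.glue H h ∈ smallUniverse t c) : H ∈ smallUniverse t c := by
  have : Finite (GlueV G H) := (G.glue H h).finV
  obtain ⟨𝓑, hd, hE⟩ := exists_decomp hGH
  have hlab : ⇑(G.glue H h).lab = glueInr G H ∘ H.lab := funext fun j => glueInl_lab G H j
  -- The copy of `H` contains the whole boundary, hence the root bag, so the decomposition of the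
  -- gluing restricts to it.
  obtain ⟨𝓒, hd', hs⟩ := hd.restrict (Y := Set.range (glueInr G H)) (Set.subset_univ _) (by
    rw [hlab]
    exact Set.range_comp_subset_range _ _)
  rw [mem_smallUniverse_iff]
  refine Generates.of_map (W := GlueV G H) (col' := (G.glue H h).color) (glueInr_injective G H) (fun _ => rfl) ?_
  rw [Set.image_univ, ← hlab]
  refine hd'.generates (loopless_map H.loopless (glueInr_injective G H)) (fun e he => ?_)
    (G.glue H h).lab.injective rfl
  obtain ⟨C, hC, heC⟩ := hE e (Multiset.mem_add.2 (Or.inr he))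
  obtain ⟨D, hD, hCD⟩ := hs C hC
  refine ⟨D, hD, fun x hx => hCD ⟨heC x hx, ?_⟩⟩
  obtain ⟨d, hd, rfl⟩ := Multiset.mem_map.1 he
  obtain ⟨y, hy, rfl⟩ := Sym2.mem_map.1 hx
  exact Set.mem_range_self _

/-! ### Closure properties of the small universe -/

theorem addEdge_mem_smallUniverse {G : BGraph t c} (ht : 2 ≤ t) (hG : G ∈ smallUniverse t c) :
    G.addEdge ht ∈ smallUniverse t c := by
  rw [mem_smallUniverse_iff] at hG ⊢
  exact hG.addEdge (by simp)

theorem relabel_mem_smallUniverse {G : BGraph t c} (p : Equiv.Perm (Fin t))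
    (hG : G ∈ smallUniverse t c) : G.relabel p ∈ smallUniverse t c := by
  rw [mem_smallUniverse_iff] at hG ⊢
  exact hG.relabel p

theorem newVertex_lab_of_ne (l : Fin c) (G : BGraph t c) {j : Fin t} (hj : (j : ℕ) ≠ 0) :
    (G.newVertex l).lab j = some (G.lab j) := if_neg hj

theorem newVertex_mem_smallUniverse {G : BGraph t c} (ht : 1 ≤ t) (l : Fin c)
    (hG : G ∈ smallUniverse t c) : G.newVertex l ∈ smallUniverse t c := by
  rw [mem_smallUniverse_iff] at hG ⊢
  have h := (hG.map (W := Option G.V) (col' := (G.newVertex l).color) (Option.some_injective _)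
    fun _ => rfl).newVertex (v := none) (by simp) ⟨0, ht⟩
  have hX : insert none (some '' Set.univ) = (Set.univ : Set (Option G.V)) :=
    Set.eq_univ_of_forall fun x => by cases x <;> simp
  have hl : Function.update (some ∘ G.lab) ⟨0, ht⟩ none = ⇑(G.newVertex l).lab := by
    funext j
    by_cases hj : (j : ℕ) = 0
    · obtain rfl : j = ⟨0, ht⟩ := Fin.ext hj
      exact Function.update_self _ _ _
    · rw [Function.update_of_ne fun hh => hj (congrArg Fin.val hh)]
      exact (newVertex_lab_of_ne l G hj).symm
  rw [hX, hl] at h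
  exact h

theorem glue_mem_smallUniverse {G H : BGraph t c} (h : G.Compat H) (hG : G ∈ smallUniverse t c)
    (hH : H ∈ smallUniverse t c) : G.glue H h ∈ smallUniverse t c := by
  rw [mem_smallUniverse_iff] at hG hH ⊢
  have h₁ := hG.map (W := GlueV G H) (col' := (G.glue H h).color) (glueInl_injective G H)
    fun _ => rfl
  have h₂ := hH.map (W := GlueV G H) (col' := (G.glue H h).color) (glueInr_injective G H)
    fun _ => rfl
  rw [show glueInr G H ∘ H.lab = glueInl G H ∘ G.lab from
    funext fun j => (glueInl_lab G H j).symm] at h₂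
  have h₃ := h₁.glue h₂ (by
    ext x
    constructor
    · rintro ⟨⟨a, -, rfl⟩, b, -, hab⟩
      obtain ⟨j, rfl, rfl⟩ := glueInl_eq_glueInr.1 hab.symm
      exact ⟨j, rfl⟩
    · rintro ⟨j, rfl⟩
      exact ⟨⟨_, trivial, rfl⟩, _, trivial, (glueInl_lab G H j).symm⟩)
  rw [show glueInl G H '' Set.univ ∪ glueInr G H '' Set.univ = Set.univ from
    Set.eq_univ_of_forall fun x => by
      rcases glueV_cases x with ⟨a, rfl⟩ | ⟨b, rfl⟩
      · exact Or.inl ⟨a, trivial, rfl⟩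
      · exact Or.inr ⟨b, trivial, rfl⟩] at h₃
  exact h₃

theorem mem_smallUniverse_of_eval {T : LTree (Op t c)} {G : BGraph t c} (h : eval T = some G) :
    G ∈ smallUniverse t c := ⟨T, G, h, LabIso.refl G⟩

/-- The edgeless graph in which every vertex is a boundary vertex. -/
def edgeless (κ : Fin t → Fin c) : BGraph t c where
  V := Fin t
  finV := inferInstance
  edges := 0
  loopless := by simp
  color := κ
  lab := Function.Embedding.refl _

theorem edgeless_mem_smallUniverse (κ : Fin t → Fin c) : edgeless κ ∈ smallUniverse t c := by
  rw [mem_smallUniverse_iff]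
  have := Generates.isolated (col := κ) (ℓ := id) Function.injective_id
  rw [Set.range_id] at this
  exact this

/-! ### Moving operators across a gluing -/

namespace BGraph

/-- Gluing on a bare boundary changes nothing; thus the profile of a graph decides whether the graph
itself is in `F`. -/
theorem glue_edgeless_iso (G : BGraph t c) (h : G.Compat (edgeless fun j => G.color (G.lab j))) :
    (G.glue _ h).Iso G := by
  refine glue_iso h (f₁ := id) (f₂ := G.lab) Function.injective_id G.lab.injective (fun a b => ?_)
    (fun x => Or.inl ⟨x, rfl⟩) ?_ (fun _ => rfl) fun _ => rfl
  · constructor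
    · rintro rfl
      exact ⟨b, rfl, rfl⟩
    · rintro ⟨j, rfl, rfl⟩
      rfl
  · simp [edgeless]

theorem glue_comm_labIso {G H : BGraph t c} (h : G.Compat H) (h' : H.Compat G) :
    (G.glue H h).LabIso (H.glue G h') := by
  obtain ⟨φ, h1, h2, h3⟩ := exists_glue_equiv (K := H.glue G h') h (f₁ := glueInr H G)
    (f₂ := glueInl H G) (glueInr_injective _ _) (glueInl_injective _ _)
    (fun a b => eq_comm.trans (glueInl_eq_glueInr.trans (by simp only [and_comm])))
    (fun x => (glueV_cases x).symm) (add_comm _ _) (fun _ => rfl) fun _ => rfl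
  exact ⟨φ, h1, h2, fun j => (h3 j).trans (glueInl_lab H G j).symm⟩

theorem addEdge_glue_iso {G H : BGraph t c} (ht : 2 ≤ t) (h : (G.addEdge ht).Compat H) :
    ((G.addEdge ht).glue H h).Iso (G.glue (H.addEdge ht) h) := by
  have key : ∀ {W : Type} (f : G.V → W) (g : H.V → W) (a b : G.V) (a' b' : H.V), f a = g a' →
      f b = g b' → (s(a, b) ::ₘ G.edges).map (Sym2.map f) + H.edges.map (Sym2.map g) =
        G.edges.map (Sym2.map f) + (s(a', b') ::ₘ H.edges).map (Sym2.map g) := by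
    intro W f g a b a' b' ha hb
    rw [Multiset.map_cons, Multiset.map_cons, Multiset.cons_add, Multiset.add_cons, Sym2.map_mk,
      Sym2.map_mk, ha, hb]
  refine glue_iso (K := G.glue (H.addEdge ht) h) h (f₁ := glueInl G (H.addEdge ht))
    (f₂ := glueInr G (H.addEdge ht))
    (glueInl_injective _ _) (glueInr_injective _ _) (fun a b => glueInl_eq_glueInr)
    glueV_cases ?_ (fun _ => rfl) fun _ => rfl
  exact key _ _ _ _ _ _ (glueInl_lab G (H.addEdge ht) _) (glueInl_lab G (H.addEdge ht) _)

theorem relabel_glue_iso {G H : BGraph t c} (p : Equiv.Perm (Fin t))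
    (h : (G.relabel p).Compat H) (h' : G.Compat (H.relabel p⁻¹)) :
    ((G.relabel p).glue H h).Iso (G.glue (H.relabel p⁻¹) h') := by
  refine glue_iso (K := G.glue (H.relabel p⁻¹) h') h (f₁ := glueInl G (H.relabel p⁻¹))
    (f₂ := glueInr G (H.relabel p⁻¹))
    (glueInl_injective _ _) (glueInr_injective _ _) (fun a b => glueInl_eq_glueInr.trans ?_)
    glueV_cases rfl (fun _ => rfl) fun _ => rfl
  constructor
  · rintro ⟨j, rfl, rfl⟩
    exact ⟨p⁻¹ j, congrArg G.lab (p.apply_symm_apply j).symm, rfl⟩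
  · rintro ⟨j, rfl, rfl⟩
    exact ⟨p j, rfl, congrArg H.lab (p.symm_apply_apply j).symm⟩

theorem compat_relabel {G H : BGraph t c} {p : Equiv.Perm (Fin t)}
    (h : (G.relabel p).Compat H) : G.Compat (H.relabel p⁻¹) := fun j =>
  (congrArg (fun i => G.color (G.lab i)) (p.apply_symm_apply j).symm).trans (h (p⁻¹ j))

theorem compat_newVertex {G H : BGraph t c} {l : Fin c} (ht : 1 ≤ t)
    (h : (G.newVertex l).Compat H) : G.Compat (H.newVertex (G.color (G.lab ⟨0, ht⟩))) := by
  intro j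
  by_cases hj : (j : ℕ) = 0
  · obtain rfl : j = ⟨0, ht⟩ := Fin.ext hj
    rfl
  · have := h j
    rw [newVertex_lab_of_ne l G hj] at this
    rw [newVertex_lab_of_ne _ H hj]
    exact this

/-- On the left, the new vertex merges with the first boundary vertex of `H`, and that of `G`
becomes interior. On the right, the roles are exchanged. Only the position of the boundary differs,
and isomorphisms ignore labels. -/
theorem newVertex_glue_iso {G H : BGraph t c} {l l' : Fin c} (ht : 1 ≤ t)
    (h : (G.newVertex l).Compat H) (h' : G.Compat (H.newVertex l')) :
    ((G.newVertex l).glue H h).Iso (G.glue (H.newVertex l') h') := by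
  have hne : ∀ a, glueInr G (H.newVertex l') (some (H.lab ⟨0, ht⟩)) ≠
      glueInl G (H.newVertex l') a := by
    intro a hab
    obtain ⟨j, rfl, hj⟩ := glueInl_eq_glueInr.1 hab.symm
    by_cases hj0 : (j : ℕ) = 0
    · obtain rfl : j = ⟨0, ht⟩ := Fin.ext hj0
      exact Option.some_ne_none _ hj
    · rw [newVertex_lab_of_ne _ _ hj0] at hj
      exact hj0 (congrArg Fin.val (H.lab.injective (Option.some.inj hj))).symm
  refine glue_iso (K := G.glue (H.newVertex l') h') h
    (f₁ := fun o : Option G.V => o.elim (glueInr G (H.newVertex l') (some (H.lab ⟨0, ht⟩)))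
      (glueInl G (H.newVertex l')))
    (f₂ := fun b => glueInr G (H.newVertex l') (some b)) ?_
    ((glueInr_injective _ _).comp (Option.some_injective _)) ?_ ?_ ?_ ?_ fun _ => rfl
  · rintro (_ | a) (_ | b) hab
    · rfl
    · exact absurd hab (hne b)
    · exact absurd hab.symm (hne a)
    · exact congrArg some (glueInl_injective _ _ hab)
  · rintro (_ | a) b
    · constructor
      · intro hab
        exact ⟨⟨0, ht⟩, rfl, (Option.some.inj (glueInr_injective _ _ hab)).symm⟩
      · rintro ⟨j, hj, rfl⟩
        by_cases hj0 : (j : ℕ) = 0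
        · obtain rfl : j = ⟨0, ht⟩ := Fin.ext hj0
          rfl
        · rw [newVertex_lab_of_ne _ _ hj0] at hj
          exact absurd hj.symm (Option.some_ne_none _)
    · refine glueInl_eq_glueInr.trans (exists_congr fun j => ?_)
      by_cases hj0 : (j : ℕ) = 0
      · obtain rfl : j = ⟨0, ht⟩ := Fin.ext hj0
        exact iff_of_false (fun hh => Option.some_ne_none _ hh.2)
          fun hh => Option.some_ne_none _ hh.1
      · rw [newVertex_lab_of_ne _ _ hj0, newVertex_lab_of_ne _ _ hj0]
        exact and_congr (Option.some_injective _).eq_iff.symm (Option.some_injective _).eq_iff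
  · intro x
    rcases glueV_cases x with ⟨a, rfl⟩ | ⟨b, rfl⟩
    · exact Or.inl ⟨some a, rfl⟩
    · rcases b with _ | b
      · exact Or.inl ⟨some (G.lab ⟨0, ht⟩), glueInl_lab G (H.newVertex l') ⟨0, ht⟩⟩
      · exact Or.inr ⟨b, rfl⟩
  · exact congrArg₂ (· + ·) (map_map_edges G.edges some _) 
      (map_map_edges H.edges some (glueInr G (H.newVertex l'))).symm
  · rintro (_ | a)
    · exact (h ⟨0, ht⟩).symm
    · rfl

theorem glue_assoc_iso {G₁ G₂ H : BGraph t c} (h₁₂ : G₁.Compat G₂) (h : (G₁.glue G₂ h₁₂).Compat H)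
    (h₂ : G₂.Compat H) (h' : G₁.Compat (G₂.glue H h₂)) :
    ((G₁.glue G₂ h₁₂).glue H h).Iso (G₁.glue (G₂.glue H h₂) h') := by
  let K := G₂.glue H h₂
  let i₂ : G₂.V → GlueV G₁ K := fun b => glueInr G₁ K (glueInl G₂ H b)
  let i₃ : H.V → GlueV G₁ K := fun b => glueInr G₁ K (glueInr G₂ H b)
  obtain ⟨f, hf, hfl, hfr⟩ := exists_glue_desc (G := G₁) (H := G₂) (f₁ := glueInl G₁ K) (f₂ := i₂)
    (glueInl_injective _ _) ((glueInr_injective G₁ K).comp (glueInl_injective _ _))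
    (fun a b => glueInl_eq_glueInr.trans (exists_congr fun j =>
      and_congr_right fun _ => (glueInl_injective G₂ H).eq_iff))
  refine glue_iso (K := G₁.glue K h') h (f₁ := f) (f₂ := i₃) hf
    ((glueInr_injective G₁ K).comp (glueInr_injective _ _)) ?_ ?_ ?_ ?_ fun _ => rfl
  · intro x b
    rcases glueV_cases x with ⟨a, rfl⟩ | ⟨a, rfl⟩
    · rw [hfl]
      refine glueInl_eq_glueInr.trans (exists_congr fun j => and_congr
        (glueInl_injective G₁ G₂).eq_iff.symm ?_)
      change glueInr G₂ H b = glueInl G₂ H (G₂.lab j) ↔ _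
      rw [glueInl_lab]
      exact (glueInr_injective G₂ H).eq_iff
    · rw [hfr]
      refine (glueInr_injective G₁ K).eq_iff.trans (glueInl_eq_glueInr.trans
        (exists_congr fun j => and_congr_left fun _ => ?_))
      change _ ↔ glueInr G₁ G₂ a = glueInl G₁ G₂ (G₁.lab j)
      rw [glueInl_lab]
      exact (glueInr_injective G₁ G₂).eq_iff.symm
  · intro x
    rcases glueV_cases x with ⟨a, rfl⟩ | ⟨b, rfl⟩
    · exact Or.inl ⟨_, hfl a⟩
    · rcases glueV_cases b with ⟨b, rfl⟩ | ⟨b, rfl⟩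
      · exact Or.inl ⟨_, hfr b⟩
      · exact Or.inr ⟨b, rfl⟩
  · have key : ∀ {A B C D E : Multiset (Sym2 (GlueV G₁ K))}, D = A + B → E = B + C →
        D + C = A + E := by
      rintro A B C _ _ rfl rfl
      exact add_assoc A B C
    exact key (map_glue_edges h₁₂ hfl hfr)
      (map_glue_edges h₂ (f := glueInr G₁ K) (f₁ := i₂) (f₂ := i₃) (fun _ => rfl) fun _ => rfl)
  · intro x
    rcases glueV_cases x with ⟨a, rfl⟩ | ⟨a, rfl⟩
    · exact congrArg (G₁.glue K h').color (hfl a)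
    · exact congrArg (G₁.glue K h').color (hfr a)

end BGraph

/-! ### From finite index to recognizability -/

/-- A tree language that is saturated by the kernel of a map with finite range is recognizable if
this kernel is compatible with forming trees. -/
theorem recognizable_of_congruence {σ : Type} [Finite σ] {S : Type*} {L : Set (LTree σ)}
    (q : LTree σ → S) (hfin : (Set.range q).Finite)
    (h₁ : ∀ a x x', q x = q x' → q (.unary a x) = q (.unary a x'))
    (h₂ : ∀ a x x' y y', q x = q x' → q y = q y' → q (.binary a x y) = q (.binary a x' y'))
    (hL : ∀ x x', q x = q x' → x ∈ L → x' ∈ L) : Recognizable L := by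
  have := hfin.to_subtype
  -- Automaton states must live in `Type`, but `S` may be in a higher universe, so the classes are
  -- numbered.
  obtain ⟨n, ⟨e⟩⟩ := Finite.exists_equiv_fin (Set.range q)
  let r : LTree σ → Fin n := fun x => e ⟨q x, x, rfl⟩
  have hr : ∀ {x x'}, r x = r x' ↔ q x = q x' := fun {x x'} =>
    e.injective.eq_iff.trans Subtype.ext_iff
  let rep : Set.range r → LTree σ := fun k => k.2.choose
  have hrep : ∀ x, q (rep ⟨r x, x, rfl⟩) = q x := fun x =>
    hr.1 (Set.mem_range_self (f := r) x).choose_spec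
  -- The extra value `none` is the start state. No tree reaches it, so `step₁` can tell a leaf from
  -- a unary node.
  let cls : LTree σ → Option (Set.range r) := fun x => some ⟨r x, x, rfl⟩
  have hcls : ∀ {x x'}, q x = q x' → cls x = cls x' := fun h =>
    congrArg some (Subtype.ext (hr.2 h))
  let A : TreeAutomaton σ :=
    { Q := Option (Set.range r)
      finQ := inferInstance
      step₁ := fun a s => s.elim (cls (.leaf a)) fun k => cls (.unary a (rep k))
      step₂ := fun a s s' => s.elim none fun k => s'.elim none fun k' =>
        cls (.binary a (rep k) (rep k'))
      start := none
      final := cls '' L }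
  have hA : ∀ x, A.state x = cls x := by
    intro x
    induction x with
    | leaf a => rfl
    | unary a x ih =>
      change A.step₁ a (A.state x) = _
      rw [ih]
      exact hcls (h₁ a _ _ (hrep x))
    | binary a x y ihx ihy =>
      change A.step₂ a (A.state x) (A.state y) = _
      rw [ihx, ihy]
      exact hcls (h₂ a _ _ _ _ (hrep x) (hrep y))
  refine ⟨A, fun x => ?_⟩
  change A.state x ∈ cls '' L ↔ _
  rw [hA]
  constructor
  · rintro ⟨y, hy, hxy⟩
    exact hL y x (hr.1 (congrArg Subtype.val (Option.some.inj hxy))) hy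
  · exact fun hx => ⟨x, hx, rfl⟩

/-- The colors of the boundary, and the graphs of the small universe that complete `G` to a graph
in `F`. -/
def profile (F : Set (BGraph t c)) (G : BGraph t c) :
    (Fin t → Fin c) × Set (smallUniverse t c) :=
  (fun j => G.color (G.lab j), {H | ∃ h : G.Compat H.1, G.glue H.1 h ∈ F})

/-! ### Equality of profiles as a congruence -/

section

variable {F : Set (BGraph t c)}

theorem color_eq_of_profile {G G' : BGraph t c} (h : profile F G = profile F G') (j : Fin t) :
    G.color (G.lab j) = G'.color (G'.lab j) := congrFun (congrArg Prod.fst h) j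

theorem glue_mem_of_profile {G G' H : BGraph t c} (h : profile F G = profile F G')
    (hH : H ∈ smallUniverse t c) (hGH : G.Compat H) (hG'H : G'.Compat H)
    (hm : G.glue H hGH ∈ F) : G'.glue H hG'H ∈ F := by
  have : (⟨H, hH⟩ : smallUniverse t c) ∈ (profile F G).2 := ⟨hGH, hm⟩
  rw [h] at this
  exact this.2

theorem profile_ext {G G' : BGraph t c} (hc : ∀ j, G.color (G.lab j) = G'.color (G'.lab j))
    (h : ∀ H ∈ smallUniverse t c, ∀ (h₁ : G.Compat H) (h₂ : G'.Compat H),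
      G.glue H h₁ ∈ F ↔ G'.glue H h₂ ∈ F) : profile F G = profile F G' := by
  refine Prod.ext (funext hc) (Set.ext fun H => ?_)
  constructor
  · rintro ⟨h₁, hm⟩
    have h₂ : G'.Compat H.1 := fun j => (hc j).symm.trans (h₁ j)
    exact ⟨h₂, (h H.1 H.2 h₁ h₂).1 hm⟩
  · rintro ⟨h₂, hm⟩
    have h₁ : G.Compat H.1 := fun j => (hc j).trans (h₂ j)
    exact ⟨h₁, (h H.1 H.2 h₁ h₂).2 hm⟩

theorem profile_eq_of_labIso (hiso : IsoInvariantOnSmall F) {G G' : BGraph t c}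
    (hG : G ∈ smallUniverse t c) (hG' : G' ∈ smallUniverse t c) (h : G.LabIso G') :
    profile F G = profile F G' :=
  profile_ext h.color_lab fun H hH h₁ h₂ => hiso _ (glue_mem_smallUniverse h₁ hG hH) _
    (glue_mem_smallUniverse h₂ hG' hH) (h.glue (LabIso.refl H) h₁ h₂).iso

/-- Graphs with equal profiles have images with equal profiles under an operator that can be moved
to the other side of a gluing. -/
theorem profile_congr (hiso : IsoInvariantOnSmall F) {G G' K K' : BGraph t c}
    (hG : G ∈ smallUniverse t c) (hG' : G' ∈ smallUniverse t c) (hK : K ∈ smallUniverse t c)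
    (hK' : K' ∈ smallUniverse t c) (hc : ∀ j, K.color (K.lab j) = K'.color (K'.lab j))
    (hp : profile F G = profile F G')
    (hm : ∀ H ∈ smallUniverse t c, ∀ (h₁ : K.Compat H) (h₂ : K'.Compat H),
      ∃ H' ∈ smallUniverse t c, ∃ (h₁' : G.Compat H') (h₂' : G'.Compat H'),
        (K.glue H h₁).Iso (G.glue H' h₁') ∧ (K'.glue H h₂).Iso (G'.glue H' h₂')) :
    profile F K = profile F K' := by
  refine profile_ext hc fun H hH h₁ h₂ => ?_
  obtain ⟨H', hH', h₁', h₂', i₁, i₂⟩ := hm H hH h₁ h₂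
  rw [hiso _ (glue_mem_smallUniverse h₁ hK hH) _ (glue_mem_smallUniverse h₁' hG hH') i₁,
    hiso _ (glue_mem_smallUniverse h₂ hK' hH) _ (glue_mem_smallUniverse h₂' hG' hH') i₂]
  exact ⟨glue_mem_of_profile hp hH' h₁' h₂', glue_mem_of_profile hp.symm hH' h₂' h₁'⟩

theorem profile_addEdge (hiso : IsoInvariantOnSmall F) {G G' : BGraph t c} (ht : 2 ≤ t)
    (hG : G ∈ smallUniverse t c) (hG' : G' ∈ smallUniverse t c) (hp : profile F G = profile F G') :
    profile F (G.addEdge ht) = profile F (G'.addEdge ht) :=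
  profile_congr hiso hG hG' (addEdge_mem_smallUniverse ht hG) (addEdge_mem_smallUniverse ht hG')
    (fun j => color_eq_of_profile hp j) hp fun H hH h₁ h₂ => ⟨H.addEdge ht, addEdge_mem_smallUniverse ht hH,
      h₁, h₂, addEdge_glue_iso ht h₁, addEdge_glue_iso ht h₂⟩

theorem profile_relabel (hiso : IsoInvariantOnSmall F) {G G' : BGraph t c}
    (p : Equiv.Perm (Fin t)) (hG : G ∈ smallUniverse t c) (hG' : G' ∈ smallUniverse t c)
    (hp : profile F G = profile F G') :
    profile F (G.relabel p) = profile F (G'.relabel p) :=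
  profile_congr hiso hG hG' (relabel_mem_smallUniverse p hG) (relabel_mem_smallUniverse p hG')
    (fun j => color_eq_of_profile hp (p j)) hp fun H hH h₁ h₂ => ⟨H.relabel p⁻¹,
      relabel_mem_smallUniverse p⁻¹ hH, compat_relabel h₁, compat_relabel h₂,
      relabel_glue_iso p h₁ _, relabel_glue_iso p h₂ _⟩

theorem profile_newVertex (hiso : IsoInvariantOnSmall F) {G G' : BGraph t c} (ht : 1 ≤ t)
    (l : Fin c) (hG : G ∈ smallUniverse t c) (hG' : G' ∈ smallUniverse t c)
    (hp : profile F G = profile F G') :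
    profile F (G.newVertex l) = profile F (G'.newVertex l) := by
  refine profile_congr hiso hG hG' (newVertex_mem_smallUniverse ht l hG)
    (newVertex_mem_smallUniverse ht l hG') (fun j => ?_) hp fun H hH h₁ h₂ => ?_
  · by_cases hj : (j : ℕ) = 0
    · obtain rfl : j = ⟨0, ht⟩ := Fin.ext hj
      rfl
    · rw [newVertex_lab_of_ne l G hj, newVertex_lab_of_ne l G' hj]
      exact color_eq_of_profile hp j
  · have h₁' := compat_newVertex ht h₁
    have h₂' : G'.Compat (H.newVertex (G.color (G.lab ⟨0, ht⟩))) := fun j =>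
      (color_eq_of_profile hp j).symm.trans (h₁' j)
    exact ⟨_, newVertex_mem_smallUniverse ht _ hH, h₁', h₂', newVertex_glue_iso ht h₁ h₁',
      newVertex_glue_iso ht h₂ h₂'⟩

/-- By associativity, the operand `H` is absorbed into the test graph. -/
theorem profile_glue_left (hiso : IsoInvariantOnSmall F) {G G' H : BGraph t c}
    (hG : G ∈ smallUniverse t c) (hG' : G' ∈ smallUniverse t c) (hH : H ∈ smallUniverse t c)
    (hp : profile F G = profile F G') (h : G.Compat H) (h' : G'.Compat H) :
    profile F (G.glue H h) = profile F (G'.glue H h') := by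
  refine profile_congr hiso hG hG' (glue_mem_smallUniverse h hG hH)
    (glue_mem_smallUniverse h' hG' hH) (fun j => color_eq_of_profile hp j) hp fun K hK h₁ h₂ => ?_
  have hHK : H.Compat K := fun j => (h j).symm.trans (h₁ j)
  exact ⟨H.glue K hHK, glue_mem_smallUniverse hHK hH hK, h, h', glue_assoc_iso h h₁ hHK h,
    glue_assoc_iso h' h₂ hHK h'⟩

theorem profile_glue (hiso : IsoInvariantOnSmall F) {G G' H H' : BGraph t c}
    (hG : G ∈ smallUniverse t c) (hG' : G' ∈ smallUniverse t c) (hH : H ∈ smallUniverse t c)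
    (hH' : H' ∈ smallUniverse t c) (hp : profile F G = profile F G')
    (hp' : profile F H = profile F H') (h : G.Compat H) (h' : G'.Compat H') :
    profile F (G.glue H h) = profile F (G'.glue H' h') := by
  have h₁ : G'.Compat H := fun j => (color_eq_of_profile hp j).symm.trans (h j)
  have h₂ : H.Compat G' := fun j => (h₁ j).symm
  have h₃ : H'.Compat G' := fun j => (h' j).symm
  rw [profile_glue_left hiso hG hG' hH hp h h₁,
    profile_eq_of_labIso hiso (glue_mem_smallUniverse h₁ hG' hH) (glue_mem_smallUniverse h₂ hH hG')
      (glue_comm_labIso h₁ h₂),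
    profile_glue_left hiso hH hH' hG' hp' h₂ h₃]
  exact profile_eq_of_labIso hiso (glue_mem_smallUniverse h₃ hH' hG')
    (glue_mem_smallUniverse h' hG' hH') (glue_comm_labIso h₃ h')

theorem mem_of_profile (hiso : IsoInvariantOnSmall F) {G G' : BGraph t c}
    (hG : G ∈ smallUniverse t c) (hG' : G' ∈ smallUniverse t c) (hp : profile F G = profile F G')
    (hm : G ∈ F) : G' ∈ F := by
  let D := edgeless fun j => G.color (G.lab j)
  have hD : D ∈ smallUniverse t c := edgeless_mem_smallUniverse _
  have h : G.Compat D := fun _ => rfl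
  have h' : G'.Compat D := fun j => (color_eq_of_profile hp j).symm
  have h₁ : G.glue D h ∈ F :=
    (hiso _ (glue_mem_smallUniverse h hG hD) _ hG (glue_edgeless_iso G h)).2 hm
  have h₂ := glue_mem_of_profile hp hD h h' h₁
  have hDD : D = edgeless fun j => G'.color (G'.lab j) :=
    congrArg edgeless (funext (color_eq_of_profile hp))
  clear_value D
  subst hDD
  exact (hiso _ (glue_mem_smallUniverse h' hG' hD) _ hG' (glue_edgeless_iso G' h')).1 h₂

/-- The congruence tests with more graphs than the profile does, so it determines the profile. -/
theorem finite_range_profile [Finite (Quotient (smallCongruence F))] :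
    (Set.range fun G : smallUniverse t c => profile F G.1).Finite := by
  let f : Quotient (smallCongruence F) → (Fin t → Fin c) × Set (smallUniverse t c) :=
    Quotient.lift (fun G => profile F G.1) fun G G' h => profile_ext h.1 fun H _ => h.2 H
  refine (Set.finite_range f).subset ?_
  rintro _ ⟨G, rfl⟩
  exact ⟨Quotient.mk _ G, rfl⟩

theorem recognizable_parseTrees (hiso : IsoInvariantOnSmall F)
    [Finite (Quotient (smallCongruence F))] : Recognizable (parseTrees F) := by
  -- Trees without a value form one extra class; in all other cases equal classes mean equal
  -- profiles in the small universe.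
  have key : ∀ x x' : LTree (Op t c), (eval x).map (profile F) = (eval x').map (profile F) →
      (eval x = none ∧ eval x' = none) ∨ ∃ G ∈ smallUniverse t c, ∃ G' ∈ smallUniverse t c,
        eval x = some G ∧ eval x' = some G' ∧ profile F G = profile F G' := by
    intro x x' h
    rcases hx : eval x with _ | G <;> rcases hx' : eval x' with _ | G' <;>
      simp only [hx, hx', Option.map_none, Option.map_some, reduceCtorEq, Option.some.injEq] at h
    · exact Or.inl ⟨rfl, rfl⟩
    · exact Or.inr ⟨G, mem_smallUniverse_of_eval hx, G', mem_smallUniverse_of_eval hx', rfl, rfl, h⟩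
  refine recognizable_of_congruence (fun x => (eval x).map (profile F)) ?_ ?_ ?_ ?_
  · refine (((finite_range_profile (F := F)).image some).insert none).subset ?_
    rintro _ ⟨x, rfl⟩
    rcases hx : eval x with _ | G
    · exact Or.inl (by simp [hx])
    · exact Or.inr ⟨_, ⟨⟨G, mem_smallUniverse_of_eval hx⟩, rfl⟩, by simp [hx]⟩
  · intro a x x' h
    rcases key x x' h with ⟨hx, hx'⟩ | ⟨G, hG, G', hG', hx, hx', hp⟩
    · simp [eval, hx, hx']
    · cases a <;> simp only [eval, hx, hx', Option.bind_some, Op.eval₁, Option.map_some,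
        Option.map_none, Option.some.injEq]
      · exact profile_addEdge hiso _ hG hG' hp
      · exact profile_newVertex hiso ‹_› _ hG hG' hp
      · exact profile_relabel hiso _ hG hG' hp
      · exact profile_relabel hiso _ hG hG' hp
  · intro a x x' y y' h h'
    rcases key x x' h with ⟨hx, hx'⟩ | ⟨G, hG, G', hG', hx, hx', hp⟩
    · simp [eval, hx, hx']
    rcases key y y' h' with ⟨hy, hy'⟩ | ⟨H, hH, H', hH', hy, hy', hp'⟩
    · simp [eval, hx, hx', hy, hy']
    cases a <;> simp only [eval, hx, hx', hy, hy', Option.bind_some, Op.eval₂]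
    have hiff : G.Compat H ↔ G'.Compat H' := forall_congr' fun j => by
      rw [color_eq_of_profile hp, color_eq_of_profile hp']
    by_cases hc : G.Compat H
    · rw [dif_pos hc, dif_pos (hiff.1 hc)]
      exact congrArg some (profile_glue hiso hG hG' hH hH' hp hp' hc (hiff.1 hc))
    · rw [dif_neg hc, dif_neg (fun hc' => hc (hiff.2 hc'))]
  · rintro x x' h ⟨G₀, hG₀, hx₀⟩
    rcases key x x' h with ⟨hx, -⟩ | ⟨G, hG, G', hG', hx, hx', hp⟩
    · simp [hx₀] at hx
    · obtain rfl : G₀ = G := Option.some.inj (hx₀.symm.trans hx)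
      exact ⟨G', mem_of_profile hiso hG hG' hp hG₀, hx'⟩

/-! ### From recognizability to finite index -/

theorem finite_quotient_smallCongruence (hF : F ⊆ smallUniverse t c)
    (hiso : IsoInvariantOnSmall F) (hrec : Recognizable (parseTrees F)) :
    Finite (Quotient (smallCongruence F)) := by
  obtain ⟨A, hA⟩ := hrec
  have := A.finQ
  choose T G hT hTG using fun K : smallUniverse t c => K.2
  -- The boundary colors are recorded separately because the state need not determine them.
  let m : smallUniverse t c → A.Q × (Fin t → Fin c) := fun K =>
    (A.state (T K), fun j => K.1.color (K.1.lab j))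
  have transfer : ∀ K₁ K₂ : smallUniverse t c, A.state (T K₁) = A.state (T K₂) →
      ∀ (H : BGraph t c) (h₁ : K₁.1.Compat H) (h₂ : K₂.1.Compat H),
        K₁.1.glue H h₁ ∈ F → K₂.1.glue H h₂ ∈ F := by
    intro K₁ K₂ hs H h₁ h₂ hm
    -- Here the arbitrary test graph acquires a parse tree, on which the automaton can run.
    have hH : H ∈ smallUniverse t c := mem_smallUniverse_of_glue (hF hm)
    obtain ⟨S, H', hS, hSH⟩ := id hH
    have h₁' : (G K₁).Compat H' := fun j =>
      ((hTG K₁).color_lab j).trans ((h₁ j).trans (hSH.color_lab j).symm)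
    have h₂' : (G K₂).Compat H' := fun j =>
      ((hTG K₂).color_lab j).trans ((h₂ j).trans (hSH.color_lab j).symm)
    have e₁ : eval (.binary .glue (T K₁) S) = some ((G K₁).glue H' h₁') := by
      simp [eval, hT, hS, Op.eval₂, h₁']
    have e₂ : eval (.binary .glue (T K₂) S) = some ((G K₂).glue H' h₂') := by
      simp [eval, hT, hS, Op.eval₂, h₂']
    have m₁ : LTree.binary .glue (T K₁) S ∈ parseTrees F :=
      ⟨_, (hiso _ (mem_smallUniverse_of_eval e₁) _ (hF hm) ((hTG K₁).glue hSH h₁' h₁).iso).2 hm, e₁⟩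
    have m₂ : LTree.binary .glue (T K₂) S ∈ parseTrees F := by
      rw [← hA] at m₁ ⊢
      change A.step₂ _ (A.state (T K₁)) _ ∈ A.final at m₁
      rwa [hs] at m₁
    obtain ⟨M, hM, hev⟩ := m₂
    obtain rfl := Option.some.inj (hev.symm.trans e₂)
    exact (hiso _ (hF hM) _ (glue_mem_smallUniverse h₂ K₂.2 hH)
      ((hTG K₂).glue hSH h₂' h₂).iso).1 hM
  refine Finite.of_injective (fun k : Quotient (smallCongruence F) => m k.out) fun k k' h => ?_
  have hs : A.state (T k.out) = A.state (T k'.out) := congrArg Prod.fst h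
  have hc := congrFun (congrArg Prod.snd h)
  rw [← k.out_eq, ← k'.out_eq]
  exact Quotient.sound ⟨hc, fun H h₁ h₂ =>
    ⟨transfer _ _ hs H h₁ h₂, transfer _ _ hs.symm H h₂ h₁⟩⟩

end

end ColoredMN

theorem theorem2 (t c : ℕ) (F : Set (ColoredMN.BGraph t c))
    (hF : F ⊆ ColoredMN.smallUniverse t c) (hiso : ColoredMN.IsoInvariantOnSmall F) :
    ColoredMN.Recognizable (ColoredMN.parseTrees F) ↔
      Finite (Quotient (ColoredMN.smallCongruence F)) :=
  ⟨ColoredMN.finite_quotient_smallCongruence hF hiso, fun _ =>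
    ColoredMN.recognizable_parseTrees hiso⟩
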